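/- A signed Young diagram is a Young diagram whose boxes carry signs $\pm$ alternating along each row, two diagrams being identified when they differ by interchanging rows of equal length. Let $\mathcal{YD}_-(n,n)$ be the set of signed Young diagrams with $n$ boxes labelled $+$ and $n$ boxes labelled $-$ in which the rows of each odd length occur with even multiplicity, half of them beginning with $-$ and half with $+$. For $\mathbf D\in\mathcal{YD}_-(n,n)$ let $\mathcal O_{\mathbf D}\subset\mathfrak{sp}_{2n}(\mathbb R)$ be the corresponding nilpotent $Sp_{2n}(\mathbb R)$-orbit: $X\in\mathcal O_{\mathbf D}$ if and only if $\mathbb R^{2n}$ has a basis, indexed by the boxes of $\mathbf D$, consisting of one Jordan chain $v,Xv,\dots,X^{d-1}v$ (with $X^dv=0$) for each row of length $d$, such that the spans of the even rows and of suitable pairs of odd rows (of equal length and opposite first signs) are mutually orthogonal for the symplectic form $\Omega=\begin{pmatrix}0&I\\-I&0\end{pmatrix}$, the two rows of such a pair are isotropic, and for each even row the sign of its first box is the sign of $\Omega(X^{d-1}v,v)$. Let $P=LN$ be a parabolic subgroup of $Sp_{2n}(\mathbb R)$ with Levi subgroup $L=GL(n-m,\mathbb R)\times Sp_{2m}(\mathbb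 R)$, and let $\mathfrak n$ be the Lie algebra of $N$. For a nilpotent orbit $\mathcal O_{\mathfrak l}\subset\mathfrak l$, let $\mathrm{Ind}_{\mathfrak l}^{\mathfrak g}\,\mathcal O_{\mathfrak l}$ be the union of the nilpotent $Sp_{2n}(\mathbb R)$-orbits that contain a nonempty (relatively) open subset of $\mathcal O_{\mathfrak l}+\mathfrak n$. **Theorem.** Let $0\le m\le n$, let $\mathbf S\in\mathcal{YD}_-(m,m)$ have rows of lengths $s_1\ge s_2\ge\dots\ge s_r>0$, and suppose that $n-m\ge r$. Then $$\mathrm{Ind}_{\mathfrak{gl}(n-m,\mathbb R)\oplus\mathfrak{sp}_{2m}(\mathbb R)}^{\mathfrak{sp}_{2n}(\mathbb R)}\ \{0\}\times\mathcal O_{\mathbf S}=\bigcup_{j=0}^{n-m-r}\mathcal O_{\mathbf D^{(j)}},$$ a union of $n-m-r+1$ distinct nilpotent orbits. Here $\mathbf D^{(j)}\in\mathcal{YD}_-(n,n)$ is the signed Young diagram obtained from $\mathbf S$ by adding one box on the left and one box on the right of every row (so that $s_i$ becomes $s_i+2$), where the alternating signs of the even rows are extended (so that the leftmost sign of an even row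 changes) and the signs of the odd rows are those prescribed in $\mathcal{YD}_-(n,n)$, and by adding $n-m-r$ new rows of length $2$, of which $j$ are labelled $(-,+)$ and $n-m-r-j$ are labelled $(+,-)$. -/

import Mathlib

open LieAlgebra.Symplectic

/-- A signed Young diagram up to interchanging rows of equal length. Signs alternate along a row, so
a row is determined by its length and the sign of its leftmost box (`1` for `+`, `-1` for `-`), and
an equivalence class of diagrams is a multiset of rows. -/
@[ext]
structure SignedYoungDiagram where
  rows : Multiset (ℕ × ℤˣ)
  pos : ∀ row ∈ rows, 0 < row.1

namespace SignedYoungDiagram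

/-- Number of boxes labelled `ε` in a row: there are `⌈length / 2⌉` of them if the leftmost box is
labelled `ε`, and `⌊length / 2⌋` otherwise. -/
def rowBoxes (ε : ℤˣ) (row : ℕ × ℤˣ) : ℕ :=
  if row.2 = ε then (row.1 + 1) / 2 else row.1 / 2

/-- Total number of boxes labelled `ε`. -/
def boxes (ε : ℤˣ) (D : SignedYoungDiagram) : ℕ :=
  (D.rows.map (rowBoxes ε)).sum

/-- Membership in `𝒴𝒟₋(n, n)`: the signature is `(n, n)`, and the leftmost boxes of the rows of a
given odd length can be arranged as `-, +, -, +, …, -, +`; that is, equally many of these rows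
start with `+` and with `-`. -/
def IsSymplectic (n : ℕ) (D : SignedYoungDiagram) : Prop :=
  D.boxes 1 = n ∧ D.boxes (-1) = n ∧
    ∀ l : ℕ, Odd l → D.rows.count (l, 1) = D.rows.count (l, -1)

/-- Add one box on the left and one box on the right of a row. In an even row the alternating signs
are extended, so the new leftmost sign is the opposite one. The signs of odd rows are prescribed by
the normalization (half of the rows of each odd length start with `-`, half with `+`). -/
def extendRow (row : ℕ × ℤˣ) : ℕ × ℤˣ :=
  (row.1 + 2, if Even row.1 then -row.2 else row.2)

/-- The diagram `D^(j)`: merge a column of length `k` to `S` from the left and another one from the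
right; of the `k - r` new rows of length two (`r` the number of rows of `S`), `j` are `(-, +)` and
`k - r - j` are `(+, -)`. Used only for `r ≤ k` and `j ≤ k - r`. -/
def induce (S : SignedYoungDiagram) (k j : ℕ) : SignedYoungDiagram where
  rows := S.rows.map extendRow + Multiset.replicate j (2, -1) +
    Multiset.replicate (k - S.rows.card - j) (2, 1)
  pos := by
    intro row h
    simp only [Multiset.mem_add, Multiset.mem_map, Multiset.mem_replicate] at h
    rcases h with (⟨x, -, rfl⟩ | ⟨-, rfl⟩) | ⟨-, rfl⟩ <;> simp [extendRow]

end SignedYoungDiagram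

section Symplectic

variable {ι κ : Type} [Fintype ι] [DecidableEq ι] [Fintype κ] [DecidableEq κ]

/-- The symplectic form with Gram matrix `[[0, I], [-I, 0]]`. Mathlib's `Matrix.J` is the negative
of this matrix; both define the same Lie algebra `sp ι ℝ` and the same symplectic group. -/
def symplForm (u v : ι ⊕ ι → ℝ) : ℝ :=
  ∑ i, (u (Sum.inl i) * v (Sum.inr i) - u (Sum.inr i) * v (Sum.inl i))

/-- The adjoint orbit of `X` under the real symplectic group. -/
def adjointOrbit (X : sp ι ℝ) : Set (sp ι ℝ) :=
  {Y | ∃ g : Matrix.symplecticGroup ι ℝ,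
    (Y : Matrix (ι ⊕ ι) (ι ⊕ ι) ℝ) =
      (g : Matrix (ι ⊕ ι) (ι ⊕ ι) ℝ) * (X : Matrix (ι ⊕ ι) (ι ⊕ ι) ℝ) *
        ((g⁻¹ : Matrix.symplecticGroup ι ℝ) : Matrix (ι ⊕ ι) (ι ⊕ ι) ℝ)}

/-- A nilpotent adjoint orbit of the real symplectic group. -/
def IsNilpotentOrbit (C : Set (sp ι ℝ)) : Prop :=
  ∃ X : sp ι ℝ, IsNilpotent (LieAlgebra.ad ℝ (sp ι ℝ) X) ∧ C = adjointOrbit X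

open Classical in
/-- The nilpotent orbit `𝒪_D`. Its elements are the `X` for which there is a basis `b`, indexed by
the boxes of `D`, such that `X` moves each box to the next one in its row and kills the last box,
and such that the symplectic form `Ω` decomposes accordingly: rows of even length are nondegenerate
and orthogonal to all other rows; rows of odd length come in pairs (of opposite signs), each such
row is isotropic and orthogonal to all rows but its partner `σ i`. Writing `v` for the basis vector
of the first box of a row of length `d` with leftmost sign `ε`, and `v'` for that of its partner,
`Ω (X ^ (d - 1) v, v') = ε`; for even `d`, where `v' = v`, this says that the sign of the row is the
sign of `Ω (X ^ (d - 1) v, v)`. -/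
def nilpotentOrbit (D : SignedYoungDiagram) : Set (sp ι ℝ) :=
  {X | ∃ (σ : D.rows.ToType → D.rows.ToType)
      (b : Module.Basis (Σ i : D.rows.ToType, Fin i.1.1) ℝ (ι ⊕ ι → ℝ)),
    Function.Involutive σ ∧
    (∀ i, Even i.1.1 → σ i = i) ∧
    (∀ i, Odd i.1.1 → (σ i).1.1 = i.1.1 ∧ (σ i).1.2 = -i.1.2) ∧
    (∀ (i : D.rows.ToType) (a : Fin i.1.1),
      (X : Matrix (ι ⊕ ι) (ι ⊕ ι) ℝ).mulVec (b ⟨i, a⟩) =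
        if h : a.1 + 1 < i.1.1 then b ⟨i, ⟨a.1 + 1, h⟩⟩ else 0) ∧
    (∀ (i i' : D.rows.ToType) (a : Fin i.1.1) (a' : Fin i'.1.1),
      symplForm (b ⟨i, a⟩) (b ⟨i', a'⟩) =
        if i' = σ i ∧ a.1 + a'.1 + 1 = i.1.1 then (-1) ^ a'.1 * ((i.1.2 : ℤ) : ℝ) else 0)}

/-- The embedding of the Levi subalgebra `gl(κ) ⊕ sp(ι)` in `sp(κ ⊕ ι)`: `A` acts by `A` on the
first half and by `-Aᵀ` on the second half of the hyperbolic space of `κ`, and `Y` acts on the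
symplectic space of `ι`. -/
def leviEmbed (A : Matrix κ κ ℝ) (Y : sp ι ℝ) : sp (κ ⊕ ι) ℝ :=
  ⟨Matrix.fromBlocks
      (Matrix.fromBlocks A 0 0 (Y : Matrix (ι ⊕ ι) (ι ⊕ ι) ℝ).toBlocks₁₁)
      (Matrix.fromBlocks 0 0 0 (Y : Matrix (ι ⊕ ι) (ι ⊕ ι) ℝ).toBlocks₁₂)
      (Matrix.fromBlocks 0 0 0 (Y : Matrix (ι ⊕ ι) (ι ⊕ ι) ℝ).toBlocks₂₁)
      (Matrix.fromBlocks (-A.transpose) 0 0 (Y : Matrix (ι ⊕ ι) (ι ⊕ ι) ℝ).toBlocks₂₂), by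
    obtain ⟨Y, hY⟩ := Y
    obtain ⟨P, Q, R, T, rfl⟩ : ∃ P Q R T, Y = Matrix.fromBlocks P Q R T :=
      ⟨_, _, _, _, (Matrix.fromBlocks_toBlocks Y).symm⟩
    simp only [sp, mem_skewAdjointMatricesLieSubalgebra, mem_skewAdjointMatricesSubmodule,
      Matrix.IsSkewAdjoint, Matrix.IsAdjointPair, Matrix.J, Matrix.fromBlocks_transpose,
      Matrix.fromBlocks_multiply, Matrix.fromBlocks_neg, Matrix.fromBlocks_inj,
      Matrix.toBlocks_fromBlocks₁₁, Matrix.toBlocks_fromBlocks₁₂, Matrix.toBlocks_fromBlocks₂₁,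
      Matrix.toBlocks_fromBlocks₂₂] at hY ⊢
    simp only [mul_zero, zero_mul, mul_one, one_mul, mul_neg, neg_mul, zero_add, add_zero, neg_neg,
      neg_inj, Matrix.transpose_neg, Matrix.transpose_zero, Matrix.transpose_transpose, neg_zero,
      Matrix.fromBlocks_neg, Matrix.fromBlocks_inj, true_and] at hY ⊢
    exact ⟨hY.1, hY.2.1, hY.2.2.1, hY.2.2.2⟩⟩

/-- The isotropic subspace spanned by the first half of the basis of the hyperbolic space of `κ`. -/
def isotropicLeft (κ ι : Type) : Submodule ℝ ((κ ⊕ ι) ⊕ (κ ⊕ ι) → ℝ) where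
  carrier := {v | (∀ i, v (Sum.inl (Sum.inr i)) = 0) ∧ ∀ p, v (Sum.inr p) = 0}
  zero_mem' := by simp
  add_mem' := by
    rintro u v ⟨h₁, h₂⟩ ⟨h₃, h₄⟩
    exact ⟨fun i => by simp [h₁, h₃], fun p => by simp [h₂, h₄]⟩
  smul_mem' := by
    rintro c v ⟨h₁, h₂⟩
    exact ⟨fun i => by simp [h₁], fun p => by simp [h₂]⟩

/-- The isotropic subspace spanned by the second half of the basis of the hyperbolic space
of `κ`. -/
def isotropicRight (κ ι : Type) : Submodule ℝ ((κ ⊕ ι) ⊕ (κ ⊕ ι) → ℝ) where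
  carrier := {v | (∀ i, v (Sum.inr (Sum.inr i)) = 0) ∧ ∀ p, v (Sum.inl p) = 0}
  zero_mem' := by simp
  add_mem' := by
    rintro u v ⟨h₁, h₂⟩ ⟨h₃, h₄⟩
    exact ⟨fun i => by simp [h₁, h₃], fun p => by simp [h₂, h₄]⟩
  smul_mem' := by
    rintro c v ⟨h₁, h₂⟩
    exact ⟨fun i => by simp [h₁], fun p => by simp [h₂]⟩

/-- The nilradical of the parabolic subalgebra stabilizing an isotropic subspace `U`: the elements
that vanish on `U` and map the orthogonal complement of `U` to `U` (hence the whole space to that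
complement). -/
def nilradicalOf (U : Submodule ℝ (ι ⊕ ι → ℝ)) : Set (sp ι ℝ) :=
  {X | (∀ u ∈ U, (X : Matrix (ι ⊕ ι) (ι ⊕ ι) ℝ).mulVec u = 0) ∧
    ∀ w : ι ⊕ ι → ℝ, (∀ u ∈ U, symplForm u w = 0) →
      (X : Matrix (ι ⊕ ι) (ι ⊕ ι) ℝ).mulVec w ∈ U}

/-- The real induced orbit of `O ⊆ 𝔩` through a parabolic subalgebra `𝔩 ⊕ 𝔫`: the union of the
nilpotent orbits that contain a nonempty relatively open subset of `O + 𝔫`. -/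
def inducedOrbit (𝔫 O : Set (sp ι ℝ)) : Set (sp ι ℝ) :=
  ⋃₀ {C | IsNilpotentOrbit C ∧ ∃ W : Set (sp ι ℝ), IsOpen W ∧
    (W ∩ Set.image2 (· + ·) O 𝔫).Nonempty ∧ W ∩ Set.image2 (· + ·) O 𝔫 ⊆ C}

end Symplectic

/-! Write k = n - m, let r be the number of rows of `S`, and let `ρ` embed the small symplectic
space as a complement of `U` in its orthogonal. The set `𝒪_S + 𝔫` consists of the `X` that kill the
k-dimensional isotropic space `U` and satisfy `X (ρ w) ≡ ρ (Y w)` modulo `U`, for some `Y ∈ 𝒪_S`.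

Suppose `ker X = U`. Since X is skew, its range is the orthogonal of its kernel, so each chain
generator `w i` of `Y` has a lift `v i` with `X (v i) = ρ (w i)`. Moving one X across the form gives
`Ω (X ^ (N + 2) (v i)) (v i') = -Ω' (Y ^ N (w i)) (w i')`: every row gains two boxes and its sign
flips. The remaining pairings are removed by correcting the generators. The symmetric form `q x y =
Ω (X x) y` is nondegenerate on the span of these chains without their last vectors. Diagonalizing q
on the orthogonal complement yields k - r further rows of length two with arbitrary signs. So X lies
in some `𝒪_{D^(j)}` (`ChainFamily.exists_extension`, `IsAdaptedFrame.exists_mem_induce`).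

The integer j is an inertia invariant: in the box basis q is a signed partial permutation, so its
indices are traces, and the positive index drops by one when j grows by one
(`ChainFamily.exists_index`). This makes the orbits distinct. It also makes them open in `𝒪_S + 𝔫`:
definiteness of q on two fixed subspaces is an open condition, it bounds the kernel by k, hence
forces `ker X = U`, and it pins down j from both sides. Each j does occur, by an explicit X.
Conversely, a nonempty open subset of `𝒪_S + 𝔫` contains an element with kernel `U`, found on a line
towards such an explicit X, so no other orbit contributes. -/

/-! ### Jordan chains adapted to a skew endomorphism -/

section ChainFamily

variable {V : Type*} [AddCommGroup V] [Module ℝ V]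

/-- A family of Jordan chain generators `v i` for a skew endomorphism `X`, whose chain of length
`(row i).1` is paired with the one of `σ i` with sign `(row i).2`. -/
structure ChainFamily {I : Type*} [DecidableEq I] (Ω : LinearMap.BilinForm ℝ V) (X : Module.End ℝ V)
    (row : I → ℕ × ℤˣ) (σ : I → I) (v : I → V) : Prop where
  invol : Function.Involutive σ
  even : ∀ i, Even (row i).1 → σ i = i
  odd : ∀ i, Odd (row i).1 → (row (σ i)).1 = (row i).1 ∧ (row (σ i)).2 = -(row i).2
  pair : ∀ i i' (N : ℕ), Ω ((X ^ N) (v i)) (v i') =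
    if i' = σ i ∧ N + 1 = (row i).1 then (((row i).2 : ℤ) : ℝ) else 0

theorem bilin_pow_skew {Ω : LinearMap.BilinForm ℝ V} {X : Module.End ℝ V}
    (hX : ∀ x y, Ω (X x) y = -Ω x (X y)) (N : ℕ) (x y : V) :
    Ω x ((X ^ N) y) = (-1) ^ N * Ω ((X ^ N) x) y := by
  induction N generalizing x y with
  | zero => simp
  | succ N ih =>
    have : Ω x (X ((X ^ N) y)) = -Ω (X x) ((X ^ N) y) := by rw [hX]; ring
    rw [pow_succ' X, Module.End.mul_apply, this, ih, ← Module.End.mul_apply, ← pow_succ X,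
      ← pow_succ' X, pow_succ]
    ring

theorem linearIndependent_of_bilin_dual {B : Type*} [Fintype B] [DecidableEq B]
    {Ω : LinearMap.BilinForm ℝ V} (b w : B → V) (c : B → ℝ) (hc : ∀ β, c β ≠ 0)
    (h : ∀ β γ, Ω (b β) (w γ) = if β = γ then c γ else 0) : LinearIndependent ℝ b := by
  rw [Fintype.linearIndependent_iff]
  intro g hg γ
  have := congrArg (fun x => Ω x (w γ)) hg
  simpa [h, hc] using this

theorem sign_ne_zero_real (ε : ℤˣ) : ((ε : ℤ) : ℝ) ≠ 0 := by
  exact_mod_cast ε.ne_zero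

theorem sign_mul_self_real (ε : ℤˣ) : ((ε : ℤ) : ℝ) * ((ε : ℤ) : ℝ) = 1 := by
  rcases Int.units_eq_one_or ε with rfl | rfl <;> norm_num

namespace ChainFamily

variable {I : Type*} [DecidableEq I] {Ω : LinearMap.BilinForm ℝ V}
  {X : Module.End ℝ V} {row : I → ℕ × ℤˣ} {σ : I → I} {v : I → V}

theorem length_eq (h : ChainFamily Ω X row σ v) (i : I) : (row (σ i)).1 = (row i).1 := by
  rcases Nat.even_or_odd (row i).1 with he | ho
  · rw [h.even i he]
  · exact (h.odd i ho).1

theorem gram (h : ChainFamily Ω X row σ v) (hX : ∀ x y, Ω (X x) y = -Ω x (X y)) (i i' : I)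
    (a a' : ℕ) : Ω ((X ^ a) (v i)) ((X ^ a') (v i')) =
      if i' = σ i ∧ a + a' + 1 = (row i).1 then (-1) ^ a' * (((row i).2 : ℤ) : ℝ) else 0 := by
  rw [bilin_pow_skew hX, ← Module.End.mul_apply, ← pow_add, h.pair, add_comm a' a, mul_ite,
    mul_zero]

variable [Fintype I]

/-- The vector of a box of the diagram. -/
def box (X : Module.End ℝ V) (row : I → ℕ × ℤˣ) (v : I → V) (β : Σ i, Fin (row i).1) : V :=
  (X ^ (β.2 : ℕ)) (v β.1)

/-- Up to sign, the dual of a box is the box at the mirrored position in the partner row. -/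
theorem linearIndependent (h : ChainFamily Ω X row σ v) (hX : ∀ x y, Ω (X x) y = -Ω x (X y)) :
    LinearIndependent ℝ (box X row v) := by
  refine linearIndependent_of_bilin_dual (Ω := Ω) _
    (fun β => (X ^ ((row β.1).1 - 1 - β.2)) (v (σ β.1)))
    (fun β => (-1) ^ ((row β.1).1 - 1 - β.2) * (((row β.1).2 : ℤ) : ℝ))
    (fun β => mul_ne_zero (pow_ne_zero _ (by norm_num)) (sign_ne_zero_real _)) ?_
  rintro ⟨i, a⟩ ⟨i', a'⟩
  rw [box, h.gram hX]
  by_cases hi : i = i'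
  · subst hi
    refine if_congr ?_ rfl rfl
    have := a.2
    have := a'.2
    simp only [true_and, Sigma.mk.injEq, heq_eq_eq, Fin.ext_iff]
    omega
  · rw [if_neg, if_neg]
    · rintro ⟨⟩
      exact hi rfl
    · rintro ⟨h1, -⟩
      exact hi (h.invol.injective h1).symm

theorem sum_length_le [FiniteDimensional ℝ V] (h : ChainFamily Ω X row σ v)
    (hX : ∀ x y, Ω (X x) y = -Ω x (X y)) :
    ∑ i, (row i).1 ≤ Module.finrank ℝ V := by
  simpa using (h.linearIndependent hX).fintype_card_le_finrank

theorem span_eq_top [FiniteDimensional ℝ V] (h : ChainFamily Ω X row σ v)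
    (hX : ∀ x y, Ω (X x) y = -Ω x (X y))
    (hdim : ∑ i, (row i).1 = Module.finrank ℝ V) :
    Submodule.span ℝ (Set.range (box X row v)) = ⊤ :=
  (h.linearIndependent hX).span_eq_top_of_card_eq_finrank' (by simpa using hdim)

/-- The basis of the boxes of the diagram. -/
noncomputable def basis [FiniteDimensional ℝ V] (h : ChainFamily Ω X row σ v)
    (hX : ∀ x y, Ω (X x) y = -Ω x (X y))
    (hdim : ∑ i, (row i).1 = Module.finrank ℝ V) : Module.Basis (Σ i, Fin (row i).1) ℝ V :=
  Module.Basis.mk (h.linearIndependent hX) (h.span_eq_top hX hdim).ge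

@[simp]
theorem basis_apply [FiniteDimensional ℝ V] (h : ChainFamily Ω X row σ v)
    (hX : ∀ x y, Ω (X x) y = -Ω x (X y)) (hdim : ∑ i, (row i).1 = Module.finrank ℝ V)
    (β : Σ i, Fin (row i).1) : h.basis hX hdim β = (X ^ (β.2 : ℕ)) (v β.1) := by
  simp [basis, box]

/-- `ChainFamily` does not require the chains to stop. Past its length, a chain vector pairs to zero
with the whole box basis, so nondegeneracy kills it. -/
theorem pow_apply_eq_zero [FiniteDimensional ℝ V] (h : ChainFamily Ω X row σ v)
    (hX : ∀ x y, Ω (X x) y = -Ω x (X y)) (hnd : ∀ x, (∀ y, Ω x y = 0) → x = 0)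
    (hdim : ∑ i, (row i).1 = Module.finrank ℝ V) (i : I) {N : ℕ} (hN : (row i).1 ≤ N) :
    (X ^ N) (v i) = 0 := by
  refine hnd _ fun y => ?_
  have : Ω ((X ^ N) (v i)) = 0 := by
    refine (h.basis hX hdim).ext fun β => ?_
    rw [basis_apply, h.gram hX, if_neg (by omega)]
    simp
  rw [this]
  simp

theorem isNilpotent [FiniteDimensional ℝ V] (h : ChainFamily Ω X row σ v)
    (hX : ∀ x y, Ω (X x) y = -Ω x (X y)) (hnd : ∀ x, (∀ y, Ω x y = 0) → x = 0)
    (hdim : ∑ i, (row i).1 = Module.finrank ℝ V) : IsNilpotent X := by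
  refine ⟨∑ i, (row i).1, (h.basis hX hdim).ext fun β => ?_⟩
  rw [basis_apply, ← Module.End.mul_apply, ← pow_add, h.pow_apply_eq_zero hX hnd hdim]
  · simp
  · have := Finset.single_le_sum (f := fun i => (row i).1) (fun _ _ => Nat.zero_le _)
      (Finset.mem_univ β.1)
    omega

end ChainFamily

end ChainFamily

/-! ### Inertia of the symmetric form `Ω (X x) y` -/

section Index

/-- The two subspaces meet only in 0. This is the half of Sylvester's law of inertia by which
indices are compared below. -/
theorem finrank_add_le_of_pos_of_nonpos {V : Type*} [AddCommGroup V] [Module ℝ V]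
    [FiniteDimensional ℝ V] (q : V → ℝ) (F K : Submodule ℝ V)
    (hF : ∀ x ∈ F, x ≠ 0 → 0 < q x) (hK : ∀ x ∈ K, q x ≤ 0) :
    Module.finrank ℝ F + Module.finrank ℝ K ≤ Module.finrank ℝ V := by
  refine Submodule.finrank_add_finrank_le_of_disjoint ?_
  rw [Submodule.disjoint_def]
  intro x hx hx'
  by_contra h0
  exact absurd (hF x hx h0) (hK x hx').not_gt

open Matrix in
/-- A symmetric real matrix with eigenvalues in `{1, 0, -1}` is positive definite on a subspace of
dimension the number of eigenvalues `1`, and nonpositive on a complementary one. -/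
theorem exists_posDef_nonpos_of_cube_eq_self {B : Type*} [Fintype B] [DecidableEq B]
    (G : Matrix B B ℝ) (hsymm : Gᵀ = G) (hcube : G * G * G = G) :
    ∃ F K : Submodule ℝ (B → ℝ), (∀ x ∈ F, x ≠ 0 → 0 < x ⬝ᵥ G *ᵥ x) ∧
      (∀ x ∈ K, x ⬝ᵥ G *ᵥ x ≤ 0) ∧
      2 * (Module.finrank ℝ F : ℝ) = (G * G).trace + G.trace ∧
      Module.finrank ℝ F + Module.finrank ℝ K = Fintype.card B := by
  -- `P` and `Q` are the spectral projections for the eigenvalues 1 and -1. The subspaces are the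
  -- range and the kernel of `P`, and the rank of `P` is its trace.
  set P : Matrix B B ℝ := (1 / 2 : ℝ) • (G * G + G) with hP
  set Q : Matrix B B ℝ := (1 / 2 : ℝ) • (G * G - G) with hQ
  have h4 : G * G * (G * G) = G * G := by rw [← mul_assoc, hcube]
  have h3' : G * (G * G) = G := by rw [← mul_assoc, hcube]
  have hPP : P * P = P := by
    simp only [hP, smul_mul_assoc, mul_smul_comm, add_mul, mul_add, h4, hcube, h3']
    module
  have hQQ : Q * Q = Q := by
    simp only [hQ, smul_mul_assoc, mul_smul_comm, sub_mul, mul_sub, h4, hcube, h3']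
    module
  have hGP : G * P = P := by
    simp only [hP, mul_smul_comm, mul_add, h3', add_comm]
  have hGPQ : G = P - Q := by
    simp only [hP, hQ]
    module
  have hQT : Qᵀ = Q := by
    simp [hQ, transpose_smul, transpose_sub, transpose_mul, hsymm]
  refine ⟨LinearMap.range P.toLin', LinearMap.ker P.toLin', ?_, ?_, ?_, ?_⟩
  · rintro _ ⟨y, rfl⟩ h0
    rw [toLin'_apply] at h0 ⊢
    rw [mulVec_mulVec, hGP]
    exact lt_of_le_of_ne (Finset.sum_nonneg fun _ _ => mul_self_nonneg _)
      (fun h => h0 (dotProduct_self_eq_zero.1 h.symm))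
  · intro x hx
    rw [LinearMap.mem_ker, toLin'_apply] at hx
    rw [hGPQ, sub_mulVec, hx, zero_sub, dotProduct_neg, neg_nonpos, ← hQQ, ← mulVec_mulVec,
      dotProduct_mulVec, ← mulVec_transpose, hQT]
    exact Finset.sum_nonneg fun _ _ => mul_self_nonneg _
  · have hid : IsIdempotentElem P.toLin' := by
      rw [IsIdempotentElem, Module.End.mul_eq_comp, ← toLin'_mul, hPP]
    have := LinearMap.IsProj.trace (LinearMap.IsIdempotentElem.isProj_range _ hid)
    rw [← this, trace_toLin'_eq, hP, trace_smul, trace_add]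
    simp
  · rw [LinearMap.finrank_range_add_finrank_ker]
    simp

/-- The contribution of a row to the signature of the symmetric form `Ω (X x) y`. -/
noncomputable def rowSignature (row : ℕ × ℤˣ) : ℝ :=
  if Even row.1 then ((row.2 : ℤ) : ℝ) * (-1) ^ (row.1 / 2 - 1) else 0

theorem sum_signedPerm_mul {B : Type*} [Fintype B] [DecidableEq B] (τ : B → B) (c : B → ℝ)
    (M : Matrix B B ℝ) (β γ : B) :
    ((Matrix.of fun β β' => if β' = τ β then c β else 0) * M) β γ = c β * M (τ β) γ := by
  simp [Matrix.mul_apply]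

namespace ChainFamily

variable {V : Type*} [AddCommGroup V] [Module ℝ V] [FiniteDimensional ℝ V]
  {I : Type*} [Fintype I] [DecidableEq I] {Ω : LinearMap.BilinForm ℝ V}
  {X : Module.End ℝ V} {row : I → ℕ × ℤˣ} {σ : I → I} {v : I → V}

/-- In the box basis, box a of a row of length d pairs only with box d - 2 - a of the partner row,
with value ±1, and last boxes pair with nothing. So the Gram matrix satisfies `G * G * G = G`. The
trace of `G * G` counts the boxes that are not last, and the trace of `G` comes from the middle of
the even rows. Taking `η = ±1` gives the positive and the negative index. -/
theorem exists_index (h : ChainFamily Ω X row σ v) (hX : ∀ x y, Ω (X x) y = -Ω x (X y))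
    (halt : ∀ x y, Ω x y = -Ω y x)
    (hdim : ∑ i, (row i).1 = Module.finrank ℝ V) (hpos : ∀ i, 0 < (row i).1)
    (η : ℝ) (hη : η * η = 1) :
    ∃ F K : Submodule ℝ V, (∀ x ∈ F, x ≠ 0 → 0 < η * Ω (X x) x) ∧
      (∀ x ∈ K, η * Ω (X x) x ≤ 0) ∧
      2 * (Module.finrank ℝ F : ℝ) =
        Module.finrank ℝ V - Fintype.card I + η * ∑ i, rowSignature (row i) ∧
      Module.finrank ℝ F + Module.finrank ℝ K = Module.finrank ℝ V := by
  set b := h.basis hX hdim with hb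
  -- On a last box the truncated subtraction returns position 0, a junk value, made harmless by `c`
  -- vanishing there.
  set τ : (Σ i, Fin (row i).1) → (Σ i, Fin (row i).1) := fun β =>
    ⟨σ β.1, ⟨(row β.1).1 - 2 - β.2, by have := β.2.2; rw [h.length_eq]; omega⟩⟩ with hτ
  set c : (Σ i, Fin (row i).1) → ℝ := fun β =>
    if β.2.1 + 1 < (row β.1).1 then
      η * ((-1) ^ ((row β.1).1 - 2 - β.2.1) * (((row β.1).2 : ℤ) : ℝ)) else 0 with hc
  set G : Matrix (Σ i, Fin (row i).1) (Σ i, Fin (row i).1) ℝ :=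
    Matrix.of fun β β' => if β' = τ β then c β else 0 with hG
  have hττ : ∀ β, β.2.1 + 1 < (row β.1).1 → τ (τ β) = β := by
    rintro ⟨i, a, ha⟩ h1
    simp only at h1
    have h2 : ∀ (i' : I) (a' : ℕ) (ha' : a' < (row i').1), i' = i → a' = a →
        (⟨i', ⟨a', ha'⟩⟩ : Σ i, Fin (row i).1) = ⟨i, ⟨a, ha⟩⟩ := by
      rintro _ _ _ rfl rfl
      rfl
    refine h2 _ _ _ (h.invol i) ?_
    change (row (σ i)).1 - 2 - ((row i).1 - 2 - a) = a
    rw [h.length_eq]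
    omega
  have hcc : ∀ β, β.2.1 + 1 < (row β.1).1 → c β * c (τ β) = 1 := by
    rintro ⟨i, a, ha⟩ h1
    simp only at h1
    obtain ⟨p, hp⟩ : ∃ p, (row i).1 = a + p + 2 := ⟨(row i).1 - a - 2, by omega⟩
    have e1 : a + p + 2 - 2 - a = p := by omega
    have e2 : a + p + 2 - 2 - p = a := by omega
    simp only [hc, hτ, h.length_eq, hp, e1, e2]
    rw [if_pos (by omega), if_pos (by omega)]
    have hs : ((-1 : ℝ) ^ p * (-1) ^ a) *
        ((((row i).2 : ℤ) : ℝ) * (((row (σ i)).2 : ℤ) : ℝ)) = 1 := by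
      rw [← pow_add]
      rcases Nat.even_or_odd (row i).1 with he | ho
      · rw [h.even i he, sign_mul_self_real, Even.neg_one_pow, one_mul]
        rw [hp] at he
        have : Even (a + p) := by simpa [Nat.even_add] using he
        rwa [add_comm]
      · rw [(h.odd i ho).2, Odd.neg_one_pow]
        · have := sign_mul_self_real (row i).2
          push_cast
          linear_combination this
        · rw [hp] at ho
          have : Odd (a + p) := by simpa [Nat.odd_add] using ho
          rwa [add_comm]
    linear_combination (η * η) * hs + hη
  have hc0 : ∀ β, ¬ β.2.1 + 1 < (row β.1).1 → c β = 0 := fun β hβ => if_neg hβ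
  have hGq : ∀ β β', G β β' = η * Ω (X (b β)) (b β') := by
    rintro ⟨i, a, ha⟩ ⟨i', a', ha'⟩
    rw [hb, basis_apply, basis_apply, ← Module.End.mul_apply, ← pow_succ', h.gram hX]
    simp only [hG, Matrix.of_apply, hc]
    by_cases h1 : i' = σ i
    · subst h1
      have ha2 := ha'
      rw [h.length_eq] at ha2
      have key : (⟨σ i, ⟨a', ha'⟩⟩ : Σ i, Fin (row i).1) = τ ⟨i, ⟨a, ha⟩⟩ ↔
          a' = (row i).1 - 2 - a := by
        simp [hτ, Fin.ext_iff]
      simp only [key, true_and]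
      by_cases h2 : a + 1 < (row i).1
      · by_cases h3 : a + 1 + a' + 1 = (row i).1
        · have h4 : a' = (row i).1 - 2 - a := by omega
          rw [if_pos h3, if_pos h4, if_pos h2, ← h4]
        · have h4 : ¬ a' = (row i).1 - 2 - a := by omega
          rw [if_neg h3, if_neg h4, mul_zero]
      · have h3 : ¬ a + 1 + a' + 1 = (row i).1 := by omega
        rw [if_neg h3, if_neg h2, ite_self, mul_zero]
    · rw [if_neg, if_neg (fun h => h1 h.1), mul_zero]
      rintro ⟨⟩
      exact h1 rfl
  have hsymm : G.transpose = G := by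
    ext β β'
    rw [Matrix.transpose_apply, hGq, hGq, hX, halt, neg_neg]
  have hGG : G * G = Matrix.diagonal fun β => if β.2.1 + 1 < (row β.1).1 then (1 : ℝ) else 0 := by
    ext β γ
    rw [hG, sum_signedPerm_mul, ← hG]
    by_cases h1 : β.2.1 + 1 < (row β.1).1
    · simp only [hG, Matrix.of_apply, hττ β h1, mul_ite, hcc β h1, Matrix.diagonal_apply, if_pos h1,
        mul_zero, eq_comm]
    · rw [hc0 β h1, zero_mul, Matrix.diagonal_apply, if_neg h1, ite_self]
  have hcube : G * G * G = G := by
    ext β γ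
    rw [hGG, Matrix.diagonal_mul]
    by_cases h1 : β.2.1 + 1 < (row β.1).1
    · rw [if_pos h1, one_mul]
    · simp [hG, hc0 β h1]
  obtain ⟨F, K, hF, hK, hFd, hFK⟩ := exists_posDef_nonpos_of_cube_eq_self G hsymm hcube
  have hq : ∀ x : (Σ i, Fin (row i).1) → ℝ, η * Ω (X (b.equivFun.symm x)) (b.equivFun.symm x) =
      x ⬝ᵥ G.mulVec x := by
    intro x
    simp only [Module.Basis.equivFun_symm_apply, map_sum, map_smul, LinearMap.sum_apply,
      LinearMap.smul_apply, smul_eq_mul, dotProduct, Matrix.mulVec, hGq, Finset.mul_sum]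
    rw [Finset.sum_comm]
    refine Finset.sum_congr rfl fun β _ => Finset.sum_congr rfl fun γ _ => ?_
    ring
  refine ⟨F.map b.equivFun.symm.toLinearMap, K.map b.equivFun.symm.toLinearMap, ?_, ?_, ?_, ?_⟩
  · rintro _ ⟨x, hx, rfl⟩ h0
    rw [LinearEquiv.coe_coe, hq]
    refine hF x hx ?_
    rintro rfl
    simp at h0
  · rintro _ ⟨x, hx, rfl⟩
    rw [LinearEquiv.coe_coe, hq]
    exact hK x hx
  · rw [LinearEquiv.finrank_map_eq, hFd, hGG, Matrix.trace_diagonal, ← hdim]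
    congr 1
    · have hcard : (Fintype.card I : ℝ) = ∑ _i : I, (1 : ℝ) := by simp
      rw [Fintype.sum_sigma, Nat.cast_sum, hcard, ← Finset.sum_sub_distrib]
      refine Finset.sum_congr rfl fun i _ => ?_
      obtain ⟨d, hd⟩ : ∃ d, (row i).1 = d + 1 := ⟨(row i).1 - 1, by have := hpos i; omega⟩
      have : ∀ n, n = d + 1 → ∑ x : Fin n, (if (x : ℕ) + 1 < n then (1 : ℝ) else 0) = n - 1 := by
        rintro _ rfl
        rw [Fin.sum_univ_castSucc]
        simp
      exact this _ hd
    · rw [Matrix.trace, Fintype.sum_sigma, Finset.mul_sum]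
      refine Finset.sum_congr rfl fun i _ => ?_
      have hdiag : ∀ x : Fin (row i).1, G.diag ⟨i, x⟩ =
          if i = σ i ∧ x.1 + 1 + x.1 + 1 = (row i).1 then
            η * ((-1) ^ x.1 * (((row i).2 : ℤ) : ℝ)) else 0 := by
        intro x
        rw [Matrix.diag_apply, hGq, hb, basis_apply, ← Module.End.mul_apply, ← pow_succ', h.gram hX,
          mul_ite, mul_zero]
      simp only [hdiag, rowSignature]
      have := hpos i
      split_ifs with he
      · have hlt : (row i).1 / 2 - 1 < (row i).1 := by omega
        obtain ⟨p, hp⟩ := he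
        rw [Finset.sum_eq_single (⟨(row i).1 / 2 - 1, hlt⟩ : Fin (row i).1)]
        · rw [if_pos ⟨(h.even i ⟨p, hp⟩).symm, by simp only; omega⟩]
          ring
        · intro x _ hx
          refine if_neg fun h' => hx (Fin.ext ?_)
          simp only
          omega
        · simp
      · rw [mul_zero]
        refine Finset.sum_eq_zero fun x _ => if_neg fun h' => he ⟨x.1 + 1, by omega⟩
  · rw [LinearEquiv.finrank_map_eq, LinearEquiv.finrank_map_eq, hFK, ← hdim]
    simp

end ChainFamily

end Index

/-! ### Normalizing pairings between chain generators -/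

section Classification

/-- In an orthogonal basis the nonisotropic vectors can be rescaled to values ±1, while the
isotropic ones lie in the radical; counting both gives the bound. -/
theorem exists_orthonormal_family {E : Type*} [AddCommGroup E] [Module ℝ E]
    [FiniteDimensional ℝ E] (q : LinearMap.BilinForm ℝ E) (hq : ∀ x y, q x y = q y x) :
    ∃ (l : ℕ) (z : Fin l → E) (ε : Fin l → ℤˣ),
      (∀ a b, q (z a) (z b) = if a = b then ((ε a : ℤ) : ℝ) else 0) ∧
      Module.finrank ℝ E ≤ l + Module.finrank ℝ (LinearMap.ker q) := by
  classical
  obtain ⟨e, he⟩ := LinearMap.BilinForm.exists_orthogonal_basis (B := q) ⟨fun x y => hq x y⟩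
  have he' : ∀ a b, a ≠ b → q (e a) (e b) = 0 := fun a b hab => he hab
  let A := {a // q (e a) (e a) ≠ 0}
  let Z := {a // ¬ q (e a) (e a) ≠ 0}
  have hZ : Fintype.card Z ≤ Module.finrank ℝ (LinearMap.ker q) := by
    have hmem : ∀ a : Z, e a ∈ LinearMap.ker q := by
      rintro ⟨a, ha⟩
      refine e.ext fun b => ?_
      by_cases hab : a = b
      · subst hab
        simpa using ha
      · simpa using he' a b hab
    have hli : LinearIndependent ℝ fun a : Z => (⟨e a, hmem a⟩ : LinearMap.ker q) := by
      refine LinearIndependent.of_comp (LinearMap.ker q).subtype ?_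
      exact e.linearIndependent.comp _ Subtype.val_injective
    exact hli.fintype_card_le_finrank
  have hcard : Module.finrank ℝ E = Fintype.card A + Fintype.card Z := by
    rw [← Fintype.card_sum, ← Fintype.card_congr (Equiv.sumCompl _).symm, Fintype.card_fin]
  let f : Fin (Fintype.card A) ≃ A := (Fintype.equivFin A).symm
  refine ⟨Fintype.card A, fun a => (Real.sqrt |q (e (f a)) (e (f a))|)⁻¹ • e (f a),
    fun a => if 0 < q (e (f a)) (e (f a)) then 1 else -1, ?_, by omega⟩
  intro a b
  by_cases hab : a = b
  · subst hab
    have h0 : q (e (f a)) (e (f a)) ≠ 0 := (f a).2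
    have hs : Real.sqrt |q (e (f a)) (e (f a))| ≠ 0 := (Real.sqrt_pos.2 (abs_pos.2 h0)).ne'
    have hm : Real.sqrt |q (e (f a)) (e (f a))| * Real.sqrt |q (e (f a)) (e (f a))| =
      |q (e (f a)) (e (f a))| := Real.mul_self_sqrt (abs_nonneg _)
    simp only [map_smul, LinearMap.smul_apply, smul_eq_mul, if_true]
    field_simp
    rw [pow_two, hm]
    split_ifs with h1
    · simp [abs_of_pos h1]
    · simp [abs_of_nonpos (not_lt.1 h1)]
  · rw [if_neg hab]
    have : (f a).1 ≠ (f b).1 := fun h => hab (f.injective (Subtype.val_injective h))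
    simp [he' _ _ this]

variable {V : Type*} [AddCommGroup V] [Module ℝ V] {Ω : LinearMap.BilinForm ℝ V}
  {X : Module.End ℝ V}

/-- Killing the values `Ω (X ^ e (v i)) (v i')` by adding multiples of dual vectors annihilated by
`X ^ (e + 1)`. -/
theorem exists_correction (hX : ∀ x y, Ω (X x) y = -Ω x (X y)) (halt : ∀ x y, Ω x y = -Ω y x)
    {I : Type*} [Fintype I] [DecidableEq I] (e : ℕ) (v y : I → V)
    (hy : ∀ l i, Ω ((X ^ e) (y l)) (v i) = if l = i then 1 else 0)
    (hy0 : ∀ l, (X ^ (e + 1)) (y l) = 0)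
    (hyy : ∀ l l', Ω ((X ^ e) (y l)) (y l') = 0) :
    ∃ v' : I → V, (∀ i i', Ω ((X ^ e) (v' i)) (v' i') = 0) ∧
      (∀ i N, e < N → (X ^ N) (v' i) = (X ^ N) (v i)) ∧
      ∀ i i' N, e < N → Ω ((X ^ N) (v' i)) (v' i') = Ω ((X ^ N) (v i)) (v i') := by
  set M : I → I → ℝ := fun i l => Ω ((X ^ e) (v i)) (v l) with hM
  have hflip : ∀ N x y, Ω ((X ^ N) x) y = -((-1) ^ N * Ω ((X ^ N) y) x) := by
    intro N x y
    rw [halt, bilin_pow_skew hX]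
  have hyN : ∀ N, e < N → ∀ l, (X ^ N) (y l) = 0 := by
    intro N hN l
    obtain ⟨d, rfl⟩ := Nat.exists_eq_add_of_lt hN
    rw [show e + d + 1 = d + (e + 1) by ring, pow_add, Module.End.mul_apply, hy0, map_zero]
  have hz : ∀ i N, e < N → (X ^ N) (v i + ∑ l, (-(1 / 2) * M i l) • y l) = (X ^ N) (v i) := by
    intro i N hN
    simp [map_sum, hyN N hN]
  -- Correcting either argument subtracts half of `M i i'`, because `M i i' = -(-1) ^ e * M i' i`;
  -- the term with both corrections vanishes by `hyy`.
  refine ⟨fun i => v i + ∑ l, (-(1 / 2) * M i l) • y l, ?_, hz, ?_⟩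
  · intro i i'
    have h1 : Ω ((X ^ e) (∑ l, (-(1 / 2) * M i l) • y l)) (v i') = -(1 / 2) * M i i' := by
      simp [map_sum, LinearMap.sum_apply, hy]
    have h2 : Ω ((X ^ e) (∑ l, (-(1 / 2) * M i' l) • y l)) (v i) = -(1 / 2) * M i' i := by
      simp [map_sum, LinearMap.sum_apply, hy]
    have h3 : Ω ((X ^ e) (∑ l, (-(1 / 2) * M i l) • y l)) (∑ l, (-(1 / 2) * M i' l) • y l) = 0 := by
      simp [map_sum, LinearMap.sum_apply, hyy]
    have h4 : M i i' = -((-1) ^ e * M i' i) := hflip _ _ _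
    have h5 : Ω ((X ^ e) (v i)) (∑ l, (-(1 / 2) * M i' l) • y l) = -(1 / 2) * M i i' := by
      rw [hflip, h2, h4]
      ring
    simp only [map_add, LinearMap.add_apply]
    rw [h1, h3, h5]
    simp only [hM]
    ring
  · intro i i' N hN
    rw [hz i N hN, hflip, hz i' N hN, ← hflip]

/-- Only the pairings of the generators themselves (N = 0) are unconstrained. They are cancelled by
the last vectors of the partner chains, which are killed by X and, as lengths are at least 2, pair
to zero with each other. -/
theorem exists_chainFamily_of_pair (hX : ∀ x y, Ω (X x) y = -Ω x (X y))
    (halt : ∀ x y, Ω x y = -Ω y x) {I : Type*} [Fintype I] [DecidableEq I]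
    {row : I → ℕ × ℤˣ} {σ : I → I} {v : I → V} (hlen : ∀ i, 2 ≤ (row i).1)
    (hinv : Function.Involutive σ) (heven : ∀ i, Even (row i).1 → σ i = i)
    (hodd : ∀ i, Odd (row i).1 → (row (σ i)).1 = (row i).1 ∧ (row (σ i)).2 = -(row i).2)
    (htop : ∀ i, (X ^ (row i).1) (v i) = 0)
    (hpair : ∀ i i' N, 0 < N → Ω ((X ^ N) (v i)) (v i') =
      if i' = σ i ∧ N + 1 = (row i).1 then (((row i).2 : ℤ) : ℝ) else 0) :
    ∃ v' : I → V, ChainFamily Ω X row σ v' := by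
  have hl : ∀ i, (row (σ i)).1 = (row i).1 := by
    intro i
    rcases Nat.even_or_odd (row i).1 with he | ho
    · rw [heven i he]
    · exact (hodd i ho).1
  suffices h : _ ∧ _ ∧ _ by
    obtain ⟨v', h0, -, hN⟩ := exists_correction hX halt 0 v
      (fun l => (((row (σ l)).2 : ℤ) : ℝ) • (X ^ ((row l).1 - 1)) (v (σ l))) h.1 h.2.1 h.2.2
    refine ⟨v', hinv, heven, hodd, fun i i' N => ?_⟩
    rcases Nat.eq_zero_or_pos N with rfl | hpos
    · rw [h0, if_neg]
      have := hlen i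
      omega
    · rw [hN i i' N hpos, hpair i i' N hpos]
  refine ⟨?_, ?_, ?_⟩
  · intro l i
    have := hlen l
    have h1 : (row l).1 - 1 + 1 = (row (σ l)).1 := by rw [hl]; omega
    simp only [pow_zero, Module.End.one_apply, map_smul, LinearMap.smul_apply, smul_eq_mul]
    rw [hpair _ _ _ (by omega), hinv l]
    by_cases hli : l = i
    · rw [if_pos ⟨hli.symm, h1⟩, if_pos hli, sign_mul_self_real]
    · rw [if_neg (fun h => hli h.1.symm), if_neg hli, mul_zero]
  · intro l
    have := hlen l
    rw [zero_add, pow_one, map_smul, ← Module.End.mul_apply, ← pow_succ',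
      show (row l).1 - 1 + 1 = (row (σ l)).1 by rw [hl]; omega, htop, smul_zero]
  · intro l l'
    have := hlen l
    have := hlen l'
    simp only [pow_zero, Module.End.one_apply, map_smul, LinearMap.smul_apply, smul_eq_mul]
    rw [bilin_pow_skew hX, ← Module.End.mul_apply, ← pow_add, hpair _ _ _ (by omega), if_neg]
    · simp
    · rw [hl]
      omega

end Classification

/-! ### Lifting chains through `(ker X)ᗮ / ker X` -/

section Extension

/-- The labels of the rows extended by one box on each side, together with new rows of length
two. -/
def extendedRow {I A : Type*} (row : I → ℕ × ℤˣ) (ε : A → ℤˣ) : I ⊕ A → ℕ × ℤˣ :=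
  Sum.elim (fun i => ((row i).1 + 2, -(row i).2)) fun a => (2, ε a)

variable {V W I : Type*} [AddCommGroup V] [Module ℝ V] [AddCommGroup W] [Module ℝ W]
  [Fintype I] [DecidableEq I] {Ω : LinearMap.BilinForm ℝ V} {Ω' : LinearMap.BilinForm ℝ W}
  {X : Module.End ℝ V} {Y : Module.End ℝ W} {ρ : W →ₗ[ℝ] V}
  {row : I → ℕ × ℤˣ} {σ : I → I} {w : I → W}

/-- An equality after applying X is a congruence modulo `ker X`; this avoids passing to a quotient
space. -/
theorem map_pow_succ_lift {x : V} {y : W} (hρY : ∀ y, X (X (ρ y)) = X (ρ (Y y)))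
    (hxy : X (X x) = X (ρ y)) (N : ℕ) : X ((X ^ (N + 1)) x) = X (ρ ((Y ^ N) y)) := by
  induction N with
  | zero => simpa using hxy
  | succ N ih =>
    rw [pow_succ' X, Module.End.mul_apply, ih, hρY, pow_succ' Y, Module.End.mul_apply]

omit [Fintype I] in
-- Modulo `ker X`, which is orthogonal to the image of `ρ`, the vector `X ^ (N + 1) (v i)` is `ρ (Y
-- ^ N (w i))`. Moving the last X to `v i'` costs a sign: hence rows longer by two with opposite
-- signs.
theorem ChainFamily.pair_lift (h : ChainFamily Ω' Y row σ w)
    (hX : ∀ x y, Ω (X x) y = -Ω x (X y)) (hρ : ∀ y z, Ω (ρ y) (ρ z) = Ω' y z)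
    (hperp : ∀ x, X x = 0 → ∀ y, Ω x (ρ y) = 0)
    (hρY : ∀ y, X (X (ρ y)) = X (ρ (Y y))) {v : I → V} (hv : ∀ i, X (v i) = ρ (w i))
    (i i' : I) (N : ℕ) : Ω ((X ^ (N + 2)) (v i)) (v i') =
      if i' = σ i ∧ N + 1 = (row i).1 then -(((row i).2 : ℤ) : ℝ) else 0 := by
  have h0 : X ((X ^ (N + 1)) (v i) - ρ ((Y ^ N) (w i))) = 0 := by
    rw [map_sub, map_pow_succ_lift hρY (by rw [hv]) N, sub_self]
  have h1 := hperp _ h0 (w i')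
  rw [map_sub, LinearMap.sub_apply, hρ, sub_eq_zero] at h1
  rw [pow_succ' X, Module.End.mul_apply, hX, hv, h1, h.pair]
  split_ifs <;> simp

/-- Lifts of the chain generators for which the form pairs chains as prescribed, up to the values
on the generators themselves. -/
theorem ChainFamily.exists_lift [FiniteDimensional ℝ W] (h : ChainFamily Ω' Y row σ w)
    (hX : ∀ x y, Ω (X x) y = -Ω x (X y)) (halt : ∀ x y, Ω x y = -Ω y x)
    (hpos : ∀ i, 0 < (row i).1) (hYtop : ∀ i, (Y ^ (row i).1) (w i) = 0)
    (hρ : ∀ y z, Ω (ρ y) (ρ z) = Ω' y z) (hperp : ∀ x, X x = 0 → ∀ y, Ω x (ρ y) = 0)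
    (hρY : ∀ y, X (X (ρ y)) = X (ρ (Y y))) (hrange : ∀ y, ∃ x, X x = ρ y) :
    ∃ v : I → V, (∀ i, X (X (v i)) = X (ρ (w i))) ∧
      (∀ i, (X ^ ((row i).1 + 2)) (v i) = 0) ∧
      ∀ i i' N, 0 < N → Ω ((X ^ N) (v i)) (v i') =
        if i' = σ i ∧ N + 1 = (row i).1 + 2 then -(((row i).2 : ℤ) : ℝ) else 0 := by
  choose u hu using fun i => hrange (w i)
  have hpair := h.pair_lift hX hρ hperp hρY hu
  have htop : ∀ x i, X (X x) = X (ρ (w i)) → (X ^ ((row i).1 + 2)) x = 0 := by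
    intro x i hx
    rw [pow_succ' X, Module.End.mul_apply, map_pow_succ_lift hρY hx, hYtop]
    simp
  suffices hs : _ ∧ _ ∧ _ by
    -- Pairings with N ≥ 2 are already right, so N = 1 is corrected, using the next-to-last vectors
    -- of the lifted partner chains. Afterwards `X (v i)` equals `ρ (w i)` only modulo `ker X`.
    obtain ⟨v, h1, hN, hpN⟩ := exists_correction hX halt 1 u
      (fun l => -(((row (σ l)).2 : ℤ) : ℝ) • (X ^ (row l).1) (u (σ l))) hs.1 hs.2.1 hs.2.2
    have hXX : ∀ i, X (X (v i)) = X (ρ (w i)) := by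
      intro i
      have := hN i 2 (by norm_num)
      rw [pow_two, Module.End.mul_apply, Module.End.mul_apply, hu] at this
      exact this
    refine ⟨v, hXX, fun i => htop _ _ (hXX i), fun i i' N hN0 => ?_⟩
    obtain rfl | ⟨N, rfl⟩ : N = 1 ∨ ∃ M, N = M + 2 := by
      rcases Nat.lt_or_ge N 2 with h2 | h2
      · left; omega
      · right; exact ⟨N - 2, by omega⟩
    · rw [h1, if_neg]
      have := hpos i
      omega
    · rw [hpN i i' _ (by omega), hpair]
      refine if_congr (and_congr_right fun _ => ?_) rfl rfl
      omega
  have hl := h.length_eq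
  refine ⟨?_, ?_, ?_⟩
  · intro l i
    obtain ⟨d, hd⟩ : ∃ d, (row l).1 = d + 1 := ⟨(row l).1 - 1, by have := hpos l; omega⟩
    rw [map_smul, map_smul, ← Module.End.mul_apply, ← pow_add, hd, show 1 + (d + 1) = d + 2 by ring,
      LinearMap.smul_apply, hpair, h.invol l, hl, hd]
    by_cases hli : l = i
    · rw [if_pos ⟨hli.symm, rfl⟩, if_pos hli, smul_eq_mul, neg_mul_neg, sign_mul_self_real]
    · rw [if_neg (fun h => hli h.1.symm), if_neg hli, smul_zero]
  · intro l
    rw [map_smul, ← Module.End.mul_apply, ← pow_add, show 1 + 1 + (row l).1 = (row (σ l)).1 + 2 by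
      rw [hl]; ring, htop _ _ (by rw [hu]), smul_zero]
  · intro l l'
    obtain ⟨d, hd⟩ : ∃ d, (row l').1 = d + 1 := ⟨(row l').1 - 1, by have := hpos l'; omega⟩
    have hpl := hpos l
    rw [map_smul, map_smul, map_smul, LinearMap.smul_apply, bilin_pow_skew hX,
      ← Module.End.mul_apply, ← Module.End.mul_apply, ← pow_add, ← pow_add,
      show (row l').1 + 1 + (row l).1 = (d + (row l).1) + 2 by omega, hpair, if_neg]
    · simp
    · rw [hl]
      omega

/-- If the endomorphism induced by `X` on `(ker X)ᗮ / ker X` has a chain family, then `X` has a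
chain family with all rows extended and with new rows of length two. -/
theorem ChainFamily.exists_extension [FiniteDimensional ℝ V] [FiniteDimensional ℝ W]
    (h : ChainFamily Ω' Y row σ w)
    (hX : ∀ x y, Ω (X x) y = -Ω x (X y)) (halt : ∀ x y, Ω x y = -Ω y x)
    (hnd : ∀ x, (∀ y, Ω x y = 0) → x = 0)
    (hY : ∀ x y, Ω' (Y x) y = -Ω' x (Y y)) (hnd' : ∀ x, (∀ y, Ω' x y = 0) → x = 0)
    (hpos : ∀ i, 0 < (row i).1) (hdim' : ∑ i, (row i).1 = Module.finrank ℝ W)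
    {k : ℕ} (hdim : Module.finrank ℝ V = Module.finrank ℝ W + 2 * k)
    (hker : Module.finrank ℝ (LinearMap.ker X) = k)
    (hρ : ∀ y z, Ω (ρ y) (ρ z) = Ω' y z) (hperp : ∀ x, X x = 0 → ∀ y, Ω x (ρ y) = 0)
    (hρY : ∀ y, X (X (ρ y)) = X (ρ (Y y))) (hrange : ∀ y, ∃ x, X x = ρ y)
    (hXρ : ∀ x, ∃ y, X (X x - ρ y) = 0) :
    ∃ (l : ℕ) (ε : Fin l → ℤˣ) (v : I ⊕ Fin l → V), l + Fintype.card I = k ∧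
      ChainFamily Ω X (extendedRow row ε) (Sum.map σ id) v := by
  obtain ⟨v, hv, hvtop, hpair⟩ := h.exists_lift hX halt hpos
    (fun i => h.pow_apply_eq_zero hY hnd' hdim' i le_rfl) hρ hperp hρY hrange
  have hl := h.length_eq
  set q : LinearMap.BilinForm ℝ V := LinearMap.BilinForm.compLeft Ω X with hqdef
  have hq : ∀ x y, q x y = Ω (X x) y := fun x y => rfl
  have hqsymm : ∀ x y, q x y = q y x := fun x y => by rw [hq, hq, hX, halt, neg_neg]
  -- the span of all but the last vectors of the chains
  let f : (Σ i, Fin ((row i).1 + 1)) → V := fun β => (X ^ (β.2 : ℕ)) (v β.1)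
  let f' : (Σ i, Fin ((row i).1 + 1)) → V := fun β => (X ^ ((row β.1).1 - β.2)) (v (σ β.1))
  have hf'mem : ∀ β, f' β ∈ Submodule.span ℝ (Set.range f) := by
    intro β
    refine Submodule.subset_span
      ⟨⟨σ β.1, ⟨(row β.1).1 - β.2, by rw [hl]; omega⟩⟩, rfl⟩
  have hff' : ∀ β γ, q (f β) (f' γ) =
      if β = γ then (-1) ^ ((row γ.1).1 - γ.2) * -(((row γ.1).2 : ℤ) : ℝ) else 0 := by
    rintro ⟨i, a⟩ ⟨i', a'⟩
    have ha := a.2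
    have ha' := a'.2
    simp only [hq, f, f']
    rw [bilin_pow_skew hX, ← Module.End.mul_apply, ← Module.End.mul_apply, ← pow_succ, ← pow_add,
      hpair _ _ _ (by omega), mul_ite, mul_zero]
    by_cases hi : i = i'
    · subst hi
      refine if_congr ?_ rfl rfl
      simp only [true_and, Sigma.mk.injEq, heq_eq_eq, Fin.ext_iff]
      omega
    · rw [if_neg, if_neg]
      · rintro ⟨⟩
        exact hi rfl
      · rintro ⟨h1, -⟩
        exact hi (h.invol.injective h1).symm
  have hne : ∀ γ : (Σ i, Fin ((row i).1 + 1)),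
      (-1 : ℝ) ^ ((row γ.1).1 - γ.2) * -(((row γ.1).2 : ℤ) : ℝ) ≠ 0 := fun γ =>
    mul_ne_zero (pow_ne_zero _ (by norm_num)) (neg_ne_zero.2 (sign_ne_zero_real _))
  have hfli : LinearIndependent ℝ f := linearIndependent_of_bilin_dual f f' _ hne hff'
  set F := Submodule.span ℝ (Set.range f) with hF
  have hFdim : Module.finrank ℝ F = Module.finrank ℝ W + Fintype.card I := by
    rw [hF, finrank_span_eq_card hfli, ← hdim']
    simp [Finset.sum_add_distrib]
  set E := q.orthogonal F with hE
  have hrefl : q.IsRefl := fun x y hxy => by rw [hqsymm, hxy]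
  -- `q` is nondegenerate on `F`, since the `q`-dual family `f'` of `f` lies in `F` too.
  have hcompl : IsCompl F E := by
    rw [hE, LinearMap.BilinForm.isCompl_orthogonal_iff_disjoint hrefl, Submodule.disjoint_def]
    intro x hx hx'
    rw [hF, Submodule.mem_span_range_iff_exists_fun] at hx
    obtain ⟨c, rfl⟩ := hx
    have hc : ∀ γ, c γ = 0 := by
      intro γ
      have h1 : q (f' γ) (∑ β, c β • f β) = 0 := hx' _ (hf'mem γ)
      rw [hqsymm] at h1
      simp only [map_sum, map_smul, LinearMap.sum_apply, LinearMap.smul_apply, hff', smul_eq_mul,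
        mul_ite, mul_zero, Finset.sum_ite_eq', Finset.mem_univ, if_true] at h1
      exact (mul_eq_zero.1 h1).resolve_right (hne γ)
    simp [hc]
  have hEdim : Module.finrank ℝ F + Module.finrank ℝ E = Module.finrank ℝ V :=
    Submodule.finrank_add_eq_of_isCompl hcompl
  obtain ⟨l, z, ε, hz, hlE⟩ := exists_orthonormal_family (q.restrict E) (fun x y => hqsymm x y)
  -- A radical vector of `q` on `E` is `q`-orthogonal to `F ⊔ E = ⊤`, hence lies in `ker X`.
  have hkerE : Module.finrank ℝ (LinearMap.ker (q.restrict E)) ≤ k := by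
    have hmem : ∀ x : LinearMap.ker (q.restrict E), ((x : E) : V) ∈ LinearMap.ker X := by
      rintro ⟨⟨x, hxE⟩, hx⟩
      refine hnd _ fun y => ?_
      obtain ⟨y₁, hy₁, y₂, hy₂, rfl⟩ := Submodule.mem_sup.1
        (show y ∈ F ⊔ E by rw [hcompl.sup_eq_top]; trivial)
      have h1 : q x y₁ = 0 := by rw [hqsymm]; exact hxE y₁ hy₁
      have h2 : q x y₂ = 0 := LinearMap.congr_fun (LinearMap.mem_ker.1 hx) ⟨y₂, hy₂⟩
      rw [← hq, map_add, h1, h2, add_zero]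
    rw [← hker]
    refine LinearMap.finrank_le_finrank_of_injective
      (f := (E.subtype ∘ₗ (LinearMap.ker (q.restrict E)).subtype).codRestrict _ hmem) ?_
    intro x y hxy
    exact Subtype.ext (Subtype.ext (congrArg (fun t : LinearMap.ker X => (t : V)) hxy))
  have hzF : ∀ a, ∀ x ∈ F, q x (z a) = 0 := fun a x hx => (z a).2 x hx
  -- `X (z a)` is orthogonal to `ker X`, and to the image of `ρ` because that is spanned, modulo
  -- `ker X`, by vectors of `F`. Every `X y` lies in the sum of these two spaces.
  have hXz : ∀ a, X (X (z a)) = 0 := by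
    intro a
    have hk : ∀ x, X x = 0 → Ω (X (z a)) x = 0 := fun x hx => by rw [hX, hx, map_zero, neg_zero]
    have hW : (Ω (X (z a))) ∘ₗ ρ = 0 := by
      refine (h.basis hY hdim').ext fun β => ?_
      have h0 : X ((X ^ (β.2.1 + 1)) (v β.1) - ρ ((Y ^ β.2.1) (w β.1))) = 0 := by
        rw [map_sub, map_pow_succ_lift hρY (hv _), sub_self]
      have h1 : q ((X ^ (β.2.1 + 1)) (v β.1)) (z a) = 0 :=
        hzF a _ (Submodule.subset_span ⟨⟨β.1, ⟨β.2.1 + 1, by omega⟩⟩, rfl⟩)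
      have h2 := hk _ h0
      rw [map_sub, ← hq, hqsymm, h1, zero_sub, neg_eq_zero] at h2
      simpa using h2
    refine hnd _ fun y => ?_
    obtain ⟨y', hy'⟩ := hXρ y
    have h1 := hk _ hy'
    rw [map_sub, sub_eq_zero] at h1
    rw [hX, h1, neg_eq_zero]
    exact LinearMap.congr_fun hW y'
  have hzN : ∀ a N, 1 < N → (X ^ N) (z a : V) = 0 := by
    intro a N hN
    obtain ⟨d, rfl⟩ := Nat.exists_eq_add_of_lt hN
    rw [show 1 + d + 1 = d + 2 by ring, pow_add, Module.End.mul_apply, pow_two X,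
      Module.End.mul_apply, hXz, map_zero]
  have hvz : ∀ a i N, 0 < N → Ω ((X ^ N) (z a : V)) (v i) = 0 := by
    intro a i N hN
    rcases Nat.lt_or_ge 1 N with h1 | h1
    · rw [hzN a N h1]
      simp
    · obtain rfl : N = 1 := by omega
      rw [pow_one, ← hq, hqsymm]
      exact hzF a _ (Submodule.subset_span ⟨⟨i, ⟨0, by omega⟩⟩, by simp [f]⟩)
  have hfam : ∃ u : I ⊕ Fin l → V, ChainFamily Ω X (extendedRow row ε) (Sum.map σ id) u := by
    refine exists_chainFamily_of_pair (v := Sum.elim v fun a => (z a : V)) hX halt ?_ ?_ ?_ ?_ ?_ ?_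
    · rintro (i | a) <;> simp [extendedRow]
    · rintro (i | a)
      · simp [h.invol i]
      · simp
    · rintro (i | a) he
      · rw [Sum.map_inl, h.even i (by simpa [extendedRow, Nat.even_add] using he)]
      · rfl
    · rintro (i | a) ho
      · have := h.odd i (by simpa [extendedRow, Nat.odd_add] using ho)
        simp [extendedRow, this]
      · exact absurd ho (by simp [extendedRow])
    · rintro (i | a)
      · exact hvtop i
      · exact hzN a 2 (by norm_num)
    · rintro (i | a) (i' | a') N hN
      · simp only [Sum.elim_inl, hpair i i' N hN, extendedRow, Sum.map_inl, Sum.inl.injEq]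
        push_cast
        rfl
      · simp only [Sum.elim_inl, Sum.elim_inr, Sum.map_inl, reduceCtorEq, false_and, if_false]
        rw [halt, bilin_pow_skew hX, hvz a' i N hN]
        simp
      · simp only [Sum.elim_inl, Sum.elim_inr, Sum.map_inr, reduceCtorEq, false_and, if_false]
        exact hvz a i' N hN
      · simp only [Sum.elim_inr, extendedRow, Sum.map_inr, Sum.inr.injEq, id]
        rcases Nat.lt_or_ge 1 N with h1 | h1
        · rw [hzN a N h1, if_neg (by omega)]
          simp
        · obtain rfl : N = 1 := by omega
          rw [pow_one]
          refine (hz a a').trans ?_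
          simp [eq_comm]
  obtain ⟨u, hu⟩ := hfam
  refine ⟨l, ε, u, ?_, hu⟩
  -- Independence of the boxes bounds `l` above; `hlE` and `hkerE` bound it below by `k -
  -- Fintype.card I`.
  have hle := hu.sum_length_le hX
  simp only [extendedRow, Fintype.sum_sum_type, Sum.elim_inl, Sum.elim_inr, Finset.sum_add_distrib,
    hdim', Finset.sum_const, Finset.card_univ, smul_eq_mul, Fintype.card_fin] at hle
  omega

end Extension

/-! ### The concrete symplectic space, its Lie algebra and its group -/

section Concrete

variable {ι : Type} [Fintype ι] [DecidableEq ι]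

/-- `symplForm` as a bilinear form. -/
def symplBilin (ι : Type) [Fintype ι] : LinearMap.BilinForm ℝ (ι ⊕ ι → ℝ) :=
  LinearMap.mk₂ ℝ symplForm
    (fun u v w => by
      simp only [symplForm, Pi.add_apply, ← Finset.sum_add_distrib]
      exact Finset.sum_congr rfl fun i _ => by ring)
    (fun c u v => by
      simp only [symplForm, Pi.smul_apply, smul_eq_mul, Finset.mul_sum]
      exact Finset.sum_congr rfl fun i _ => by ring)
    (fun u v w => by
      simp only [symplForm, Pi.add_apply, ← Finset.sum_add_distrib]
      exact Finset.sum_congr rfl fun i _ => by ring)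
    (fun c u v => by
      simp only [symplForm, Pi.smul_apply, smul_eq_mul, Finset.mul_sum]
      exact Finset.sum_congr rfl fun i _ => by ring)

omit [DecidableEq ι] in
@[simp]
theorem symplBilin_apply (u v : ι ⊕ ι → ℝ) : symplBilin ι u v = symplForm u v := rfl

omit [DecidableEq ι] in
theorem symplBilin_neg_comm (u v : ι ⊕ ι → ℝ) : symplBilin ι u v = -symplBilin ι v u := by
  simp only [symplBilin_apply, symplForm, ← Finset.sum_neg_distrib]
  exact Finset.sum_congr rfl fun i _ => by ring

theorem symplBilin_nondegenerate (u : ι ⊕ ι → ℝ) (h : ∀ v, symplBilin ι u v = 0) : u = 0 := by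
  ext p
  rcases p with i | i
  · simpa [symplForm, Pi.single_apply] using h (Pi.single (Sum.inr i) 1)
  · simpa [symplForm, Pi.single_apply] using h (Pi.single (Sum.inl i) 1)

open Matrix in
theorem symplBilin_eq_J (u v : ι ⊕ ι → ℝ) : symplBilin ι u v = -(u ⬝ᵥ (J ι ℝ) *ᵥ v) := by
  obtain ⟨u₁, u₂, rfl⟩ : ∃ u₁ u₂, u = Sum.elim u₁ u₂ := ⟨_, _, (Sum.elim_comp_inl_inr u).symm⟩
  obtain ⟨v₁, v₂, rfl⟩ : ∃ v₁ v₂, v = Sum.elim v₁ v₂ := ⟨_, _, (Sum.elim_comp_inl_inr v).symm⟩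
  simp [J, fromBlocks_mulVec, symplForm, dotProduct, Finset.sum_sub_distrib, neg_mulVec]
  ring

open Matrix in
theorem matrix_eq_iff_dotProduct {m : Type*} [Fintype m] [DecidableEq m] (A B : Matrix m m ℝ) :
    A = B ↔ ∀ u v, u ⬝ᵥ A *ᵥ v = u ⬝ᵥ B *ᵥ v := by
  refine ⟨by rintro rfl _ _; rfl, fun h => ?_⟩
  ext i j
  simpa using h (Pi.single i 1) (Pi.single j 1)

open Matrix in
theorem mulVec_dotProduct_eq {m : Type*} [Fintype m] (A : Matrix m m ℝ) (u v : m → ℝ) :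
    (A *ᵥ u) ⬝ᵥ v = u ⬝ᵥ Aᵀ *ᵥ v := by
  rw [dotProduct_mulVec, vecMul_transpose]

open Matrix in
theorem mem_sp_iff (X : Matrix (ι ⊕ ι) (ι ⊕ ι) ℝ) :
    X ∈ sp ι ℝ ↔ ∀ u v, symplBilin ι (X *ᵥ u) v = -symplBilin ι u (X *ᵥ v) := by
  rw [sp, mem_skewAdjointMatricesLieSubalgebra, mem_skewAdjointMatricesSubmodule,
    Matrix.IsSkewAdjoint, Matrix.IsAdjointPair, matrix_eq_iff_dotProduct]
  simp only [symplBilin_eq_J, ← mulVec_mulVec, neg_mulVec, mulVec_neg, dotProduct_neg, neg_neg,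
    mulVec_dotProduct_eq]
  exact forall₂_congr fun u v => by rw [neg_eq_iff_eq_neg]

open Matrix in
theorem mem_symplecticGroup_iff (g : Matrix (ι ⊕ ι) (ι ⊕ ι) ℝ) :
    g ∈ symplecticGroup ι ℝ ↔ ∀ u v, symplBilin ι (g *ᵥ u) (g *ᵥ v) = symplBilin ι u v := by
  rw [SymplecticGroup.mem_iff', matrix_eq_iff_dotProduct]
  simp only [symplBilin_eq_J, ← mulVec_mulVec, mulVec_dotProduct_eq, neg_inj]

/-- An element of `sp ι ℝ` as an endomorphism. -/
noncomputable def spEnd (X : sp ι ℝ) : Module.End ℝ (ι ⊕ ι → ℝ) :=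
  Matrix.toLin' (X : Matrix (ι ⊕ ι) (ι ⊕ ι) ℝ)

theorem spEnd_apply (X : sp ι ℝ) (u : ι ⊕ ι → ℝ) :
    spEnd X u = (X : Matrix (ι ⊕ ι) (ι ⊕ ι) ℝ).mulVec u := Matrix.toLin'_apply _ _

theorem spEnd_skew (X : sp ι ℝ) (u v : ι ⊕ ι → ℝ) :
    symplBilin ι (spEnd X u) v = -symplBilin ι u (spEnd X v) := by
  rw [spEnd_apply, spEnd_apply]
  exact (mem_sp_iff _).1 X.2 u v

theorem exists_spEnd_eq (T : Module.End ℝ (ι ⊕ ι → ℝ))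
    (hT : ∀ u v, symplBilin ι (T u) v = -symplBilin ι u (T v)) : ∃ X : sp ι ℝ, spEnd X = T := by
  refine ⟨⟨LinearMap.toMatrix' T, (mem_sp_iff _).2 fun u v => ?_⟩, ?_⟩
  · rw [LinearMap.toMatrix'_mulVec, LinearMap.toMatrix'_mulVec, hT]
  · simp [spEnd]

theorem isNilpotent_ad_of_isNilpotent_spEnd (X : sp ι ℝ) (h : IsNilpotent (spEnd X)) :
    IsNilpotent (LieAlgebra.ad ℝ (sp ι ℝ) X) := by
  have hX : IsNilpotent (X : Matrix (ι ⊕ ι) (ι ⊕ ι) ℝ) := by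
    have := h.map (Matrix.toLinAlgEquiv' (R := ℝ) (n := ι ⊕ ι)).symm
    have h2 : (Matrix.toLinAlgEquiv' (R := ℝ) (n := ι ⊕ ι)).symm (spEnd X) = X :=
      (Matrix.toLinAlgEquiv' (R := ℝ) (n := ι ⊕ ι)).symm_apply_apply _
    rwa [h2] at this
  exact LieAlgebra.isNilpotent_ad_of_isNilpotent hX

theorem mem_adjointOrbit_iff (X Y : sp ι ℝ) : Y ∈ adjointOrbit X ↔
    ∃ g : Matrix.symplecticGroup ι ℝ, (Y : Matrix (ι ⊕ ι) (ι ⊕ ι) ℝ) *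
      (g : Matrix (ι ⊕ ι) (ι ⊕ ι) ℝ) = (g : Matrix (ι ⊕ ι) (ι ⊕ ι) ℝ) * X := by
  have h1 : ∀ g : Matrix.symplecticGroup ι ℝ, (g : Matrix (ι ⊕ ι) (ι ⊕ ι) ℝ) *
      ((g⁻¹ : Matrix.symplecticGroup ι ℝ) : Matrix (ι ⊕ ι) (ι ⊕ ι) ℝ) = 1 := fun g =>
    congrArg Subtype.val (mul_inv_cancel g)
  have h2 : ∀ g : Matrix.symplecticGroup ι ℝ,
      ((g⁻¹ : Matrix.symplecticGroup ι ℝ) : Matrix (ι ⊕ ι) (ι ⊕ ι) ℝ) *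
      (g : Matrix (ι ⊕ ι) (ι ⊕ ι) ℝ) = 1 := fun g => congrArg Subtype.val (inv_mul_cancel g)
  refine exists_congr fun g => ⟨fun h => ?_, fun h => ?_⟩
  · rw [h, mul_assoc, h2, mul_one]
  · rw [← h, mul_assoc, h1, mul_one]

theorem adjointOrbit_eq {X Y : sp ι ℝ} (h : Y ∈ adjointOrbit X) :
    adjointOrbit Y = adjointOrbit X := by
  obtain ⟨g, hg⟩ := (mem_adjointOrbit_iff _ _).1 h
  have h1 : (g : Matrix (ι ⊕ ι) (ι ⊕ ι) ℝ) *
      ((g⁻¹ : Matrix.symplecticGroup ι ℝ) : Matrix (ι ⊕ ι) (ι ⊕ ι) ℝ) = 1 :=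
    congrArg Subtype.val (mul_inv_cancel g)
  have h2 : ((g⁻¹ : Matrix.symplecticGroup ι ℝ) : Matrix (ι ⊕ ι) (ι ⊕ ι) ℝ) *
      (g : Matrix (ι ⊕ ι) (ι ⊕ ι) ℝ) = 1 := congrArg Subtype.val (inv_mul_cancel g)
  ext Z
  rw [mem_adjointOrbit_iff, mem_adjointOrbit_iff]
  constructor
  · rintro ⟨k, hk⟩
    refine ⟨k * g, ?_⟩
    rw [Submonoid.coe_mul, ← mul_assoc, hk, mul_assoc, hg, mul_assoc]
  · rintro ⟨k, hk⟩
    refine ⟨k * g⁻¹, ?_⟩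
    have h3 : ((g⁻¹ : Matrix.symplecticGroup ι ℝ) : Matrix (ι ⊕ ι) (ι ⊕ ι) ℝ) * Y =
        X * ((g⁻¹ : Matrix.symplecticGroup ι ℝ) : Matrix (ι ⊕ ι) (ι ⊕ ι) ℝ) := by
      calc _ = ((g⁻¹ : Matrix.symplecticGroup ι ℝ) : Matrix (ι ⊕ ι) (ι ⊕ ι) ℝ) * (Y * g) *
            ((g⁻¹ : Matrix.symplecticGroup ι ℝ) : Matrix (ι ⊕ ι) (ι ⊕ ι) ℝ) := by
            rw [mul_assoc, mul_assoc, h1, mul_one]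
        _ = _ := by rw [hg, ← mul_assoc, h2, one_mul]
    rw [Submonoid.coe_mul, ← mul_assoc, hk, mul_assoc, mul_assoc, h3]

end Concrete

/-! ### Independence of the indexing and of the pairing of odd rows -/

section Families

variable {V I : Type*} [AddCommGroup V] [Module ℝ V] [DecidableEq I]
  {Ω : LinearMap.BilinForm ℝ V} {X : Module.End ℝ V} {row : I → ℕ × ℤˣ} {σ : I → I} {v : I → V}

theorem ChainFamily.reindex {I' : Type*} [DecidableEq I'] (h : ChainFamily Ω X row σ v)
    (e : I' ≃ I) : ChainFamily Ω X (row ∘ e) (e.symm ∘ σ ∘ e) (v ∘ e) where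
  invol i := by simp [h.invol (e i)]
  even i hi := by simp [h.even (e i) hi]
  odd i hi := by simpa using h.odd (e i) hi
  pair i i' N := by simp [h.pair, Equiv.eq_symm_apply]

/-- Different pairings of the same odd rows are conjugate: let `τ` be `σ' ∘ σ` on odd rows of sign
-1 and the identity elsewhere. It preserves labels and intertwines `σ` with `σ'`, so permuting the
generators by `τ` changes the pairing. -/
theorem ChainFamily.exists_change_involution {W : Type*} [AddCommGroup W] [Module ℝ W]
    {Ω' : LinearMap.BilinForm ℝ W} {X' : Module.End ℝ W} {σ' : I → I} {v' : I → W}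
    (h : ChainFamily Ω X row σ v) (h' : ChainFamily Ω' X' row σ' v') :
    ∃ v'' : I → W, ChainFamily Ω' X' row σ v'' := by
  set τ : I → I := fun i =>
    if Even (row i).1 then i else if (row i).2 = 1 then i else σ' (σ i) with hτ
  have hτe : ∀ i, Even (row i).1 → τ i = i := fun i hi => if_pos hi
  have hτp : ∀ i, (row i).2 = 1 → τ i = i := fun i hi => by simp [hτ, hi]
  have hτn : ∀ i, Odd (row i).1 → (row i).2 = -1 → τ i = σ' (σ i) := fun i ho hi => by
    simp [hτ, hi, Nat.not_even_iff_odd.2 ho]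
  have hcases : ∀ i, Even (row i).1 ∨ (Odd (row i).1 ∧ (row i).2 = 1) ∨
      (Odd (row i).1 ∧ (row i).2 = -1) := by
    intro i
    rcases Nat.even_or_odd (row i).1 with he | ho
    · exact Or.inl he
    · exact Or.inr ((Int.units_eq_one_or (row i).2).imp (⟨ho, ·⟩) (⟨ho, ·⟩))
  have hrow : ∀ i, row (τ i) = row i := by
    intro i
    rcases hcases i with he | ⟨ho, h1⟩ | ⟨ho, h1⟩
    · rw [hτe i he]
    · rw [hτp i h1]
    · have h2 := h.odd i ho
      have h3 := h'.odd (σ i) (by rwa [h2.1])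
      rw [hτn i ho h1]
      exact Prod.ext (h3.1.trans h2.1) (by rw [h3.2, h2.2, neg_neg])
  have hinj : Function.Injective τ := by
    intro i j hij
    have hr : row i = row j := by rw [← hrow i, hij, hrow]
    rcases hcases i with he | ⟨ho, h1⟩ | ⟨ho, h1⟩
    · rwa [hτe i he, hτe j (by rwa [← hr])] at hij
    · rwa [hτp i h1, hτp j (by rwa [← hr])] at hij
    · rw [hτn i ho h1, hτn j (by rwa [← hr]) (by rwa [← hr])] at hij
      exact h.invol.injective (h'.invol.injective hij)
  have hcomm : ∀ i, σ' (τ i) = τ (σ i) := by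
    intro i
    rcases hcases i with he | ⟨ho, h1⟩ | ⟨ho, h1⟩
    · rw [h.even i he, hτe i he, h'.even i he]
    · have h2 := h.odd i ho
      rw [hτp i h1, hτn (σ i) (by rwa [h2.1]) (by rw [h2.2, h1]), h.invol]
    · have h2 := h.odd i ho
      rw [hτn i ho h1, hτp (σ i) (by rw [h2.2, h1, neg_neg]), h'.invol]
  refine ⟨v' ∘ τ, h.invol, h.even, h.odd, fun i i' N => ?_⟩
  simp only [Function.comp_apply, h'.pair, hrow, hcomm, hinj.eq_iff]

theorem exists_equiv_of_map_eq {I J α : Type*} [Fintype I] [Fintype J] (f : I → α) (g : J → α)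
    (h : Finset.univ.val.map f = Finset.univ.val.map g) : ∃ e : I ≃ J, ∀ i, g (e i) = f i := by
  classical
  have hcard : ∀ a, Nonempty ({i // f i = a} ≃ {j // g j = a}) := by
    intro a
    rw [← Fintype.card_eq, Fintype.card_subtype, Fintype.card_subtype]
    have := congrArg (Multiset.count a) h
    rw [Multiset.count_map, Multiset.count_map, ← Finset.filter_val, ← Finset.filter_val,
      Finset.card_val, Finset.card_val] at this
    simpa only [eq_comm] using this
  let e := (Equiv.sigmaFiberEquiv f).symm.trans ((Equiv.sigmaCongrRight fun a =>
    (hcard a).some).trans (Equiv.sigmaFiberEquiv g))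
  exact ⟨e, fun i => ((hcard (f i)).some ⟨i, rfl⟩).2⟩

end Families

theorem sum_toType {M : Type*} [AddCommMonoid M] (s : Multiset (ℕ × ℤˣ)) (f : ℕ × ℤˣ → M) :
    ∑ i : s.ToType, f i.1 = (s.map f).sum := by
  conv_rhs => rw [← Multiset.map_univ_coe s, Multiset.map_map]
  rfl

/-! ### Signed Young diagrams determine adjoint orbits -/

section Orbits

variable {ι : Type} [Fintype ι] [DecidableEq ι]

/-- Once the pairings agree, the box bases of `X` and `X'` have the same Gram matrix and the same
shift, so the change of basis is symplectic and conjugates one to the other. -/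
theorem ChainFamily.mem_adjointOrbit {I : Type*} [Fintype I] [DecidableEq I] {X X' : sp ι ℝ}
    {row : I → ℕ × ℤˣ} {σ σ' : I → I} {v v' : I → ι ⊕ ι → ℝ}
    (h : ChainFamily (symplBilin ι) (spEnd X) row σ v)
    (h' : ChainFamily (symplBilin ι) (spEnd X') row σ' v')
    (hdim : ∑ i, (row i).1 = Module.finrank ℝ (ι ⊕ ι → ℝ)) : X' ∈ adjointOrbit X := by
  obtain ⟨v'', h''⟩ := h.exists_change_involution h'
  let b := h.basis (spEnd_skew X) hdim
  let b' := h''.basis (spEnd_skew X') hdim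
  let g : (ι ⊕ ι → ℝ) →ₗ[ℝ] (ι ⊕ ι → ℝ) := (b.equiv b' (Equiv.refl _)).toLinearMap
  have hg : ∀ β, g (b β) = b' β := fun β => by simp [g]
  have hb : ∀ β, b β = (spEnd X ^ (β.2 : ℕ)) (v β.1) := fun β => by simp [b]
  have hb' : ∀ β, b' β = (spEnd X' ^ (β.2 : ℕ)) (v'' β.1) := fun β => by simp [b']
  have hpow : ∀ i N, g ((spEnd X ^ N) (v i)) = (spEnd X' ^ N) (v'' i) := by
    intro i N
    rcases Nat.lt_or_ge N (row i).1 with hN | hN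
    · have := hg ⟨i, ⟨N, hN⟩⟩
      rwa [hb, hb'] at this
    · rw [h.pow_apply_eq_zero (spEnd_skew X) symplBilin_nondegenerate hdim i hN,
        h''.pow_apply_eq_zero (spEnd_skew X') symplBilin_nondegenerate hdim i hN, map_zero]
  have hform : (symplBilin ι).compl₁₂ g g = symplBilin ι := by
    refine b.ext fun β => b.ext fun γ => ?_
    rw [LinearMap.compl₁₂_apply, hg, hg, hb, hb, hb', hb', h.gram (spEnd_skew X),
      h''.gram (spEnd_skew X')]
  have hcomm : spEnd X' ∘ₗ g = g ∘ₗ spEnd X := by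
    refine b.ext fun β => ?_
    have h1 := hpow β.1 (β.2 + 1)
    rw [pow_succ', pow_succ', Module.End.mul_apply, Module.End.mul_apply, ← hpow] at h1
    rw [LinearMap.comp_apply, LinearMap.comp_apply, hb, h1]
  refine (mem_adjointOrbit_iff _ _).2 ⟨⟨LinearMap.toMatrix' g, ?_⟩, ?_⟩
  · rw [mem_symplecticGroup_iff]
    intro u w
    rw [LinearMap.toMatrix'_mulVec, LinearMap.toMatrix'_mulVec]
    exact LinearMap.congr_fun₂ hform u w
  · have := congrArg LinearMap.toMatrix' hcomm
    rw [LinearMap.toMatrix'_comp, LinearMap.toMatrix'_comp] at this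
    simpa [spEnd] using this

theorem ChainFamily.of_mem_adjointOrbit {I : Type*} [DecidableEq I] {X X' : sp ι ℝ}
    {row : I → ℕ × ℤˣ} {σ : I → I} {v : I → ι ⊕ ι → ℝ}
    (h : ChainFamily (symplBilin ι) (spEnd X) row σ v) (hX' : X' ∈ adjointOrbit X) :
    ∃ v', ChainFamily (symplBilin ι) (spEnd X') row σ v' := by
  obtain ⟨g, hg⟩ := (mem_adjointOrbit_iff _ _).1 hX'
  have hpow : ∀ (N : ℕ) u, (spEnd X' ^ N) (g.1.mulVec u) = g.1.mulVec ((spEnd X ^ N) u) := by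
    intro N
    induction N with
    | zero => simp
    | succ N ih =>
      intro u
      rw [pow_succ, Module.End.mul_apply, spEnd_apply, Matrix.mulVec_mulVec, hg,
        ← Matrix.mulVec_mulVec, ih, pow_succ, Module.End.mul_apply, spEnd_apply]
  refine ⟨fun i => g.1.mulVec (v i), h.invol, h.even, h.odd, fun i i' N => ?_⟩
  rw [hpow, (mem_symplecticGroup_iff g.1).1 g.2, h.pair]

open Classical in
theorem mem_nilpotentOrbit_iff {D : SignedYoungDiagram}
    (hD : (D.rows.map Prod.fst).sum = Module.finrank ℝ (ι ⊕ ι → ℝ)) (X : sp ι ℝ) :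
    X ∈ nilpotentOrbit D ↔ ∃ (σ : D.rows.ToType → D.rows.ToType) (v : D.rows.ToType → _),
      ChainFamily (symplBilin ι) (spEnd X) (fun i => i.1) σ v := by
  have hdim : ∑ i : D.rows.ToType, i.1.1 = Module.finrank ℝ (ι ⊕ ι → ℝ) :=
    (sum_toType D.rows Prod.fst).trans hD
  have hpos : ∀ i : D.rows.ToType, 0 < i.1.1 := fun i => D.pos _ (Multiset.coe_mem)
  constructor
  · rintro ⟨σ, b, hinv, heven, hodd, hX, hgram⟩
    have hstep : ∀ (i : D.rows.ToType) (a : Fin i.1.1), spEnd X (b ⟨i, a⟩) =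
        if h : a.1 + 1 < i.1.1 then b ⟨i, ⟨a.1 + 1, h⟩⟩ else 0 := fun i a => by
      rw [spEnd_apply, hX]
    have hpow : ∀ (i : D.rows.ToType) (N : ℕ), (spEnd X ^ N) (b ⟨i, ⟨0, hpos i⟩⟩) =
        if h : N < i.1.1 then b ⟨i, ⟨N, h⟩⟩ else 0 := by
      intro i N
      induction N with
      | zero => simp [hpos i]
      | succ N ih =>
        rw [pow_succ', Module.End.mul_apply, ih]
        by_cases h : N < i.1.1
        · rw [dif_pos h, hstep]
        · rw [dif_neg h, map_zero, dif_neg (by omega)]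
    refine ⟨σ, fun i => b ⟨i, ⟨0, hpos i⟩⟩, hinv, heven, hodd, fun i i' N => ?_⟩
    rw [hpow]
    by_cases h : N < i.1.1
    · rw [dif_pos h, symplBilin_apply, hgram]
      simp
    · rw [dif_neg h, if_neg (by omega)]
      simp
  · rintro ⟨σ, v, h⟩
    refine ⟨σ, h.basis (spEnd_skew X) hdim, h.invol, h.even, h.odd, fun i a => ?_,
      fun i i' a a' => ?_⟩
    · rw [← spEnd_apply, ChainFamily.basis_apply, ← Module.End.mul_apply, ← pow_succ']
      split_ifs with h1
      · rw [ChainFamily.basis_apply]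
      · exact h.pow_apply_eq_zero (spEnd_skew X) symplBilin_nondegenerate hdim i (not_lt.1 h1)
    · rw [← symplBilin_apply, ChainFamily.basis_apply, ChainFamily.basis_apply,
        h.gram (spEnd_skew X)]

theorem ChainFamily.mem_nilpotentOrbit {D : SignedYoungDiagram}
    (hD : (D.rows.map Prod.fst).sum = Module.finrank ℝ (ι ⊕ ι → ℝ)) {X : sp ι ℝ}
    {I : Type*} [Fintype I] [DecidableEq I] {row : I → ℕ × ℤˣ} {σ : I → I} {v : I → ι ⊕ ι → ℝ}
    (h : ChainFamily (symplBilin ι) (spEnd X) row σ v)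
    (hrow : Finset.univ.val.map row = D.rows) : X ∈ nilpotentOrbit D := by
  classical
  obtain ⟨e, he⟩ := exists_equiv_of_map_eq (fun i : D.rows.ToType => i.1) row
    (by rw [hrow]; exact Multiset.map_univ_coe D.rows)
  have hfam := h.reindex e
  rw [show row ∘ e = fun i => i.1 from funext he] at hfam
  exact (mem_nilpotentOrbit_iff hD X).2 ⟨_, _, hfam⟩

theorem nilpotentOrbit_eq_adjointOrbit {D : SignedYoungDiagram}
    (hD : (D.rows.map Prod.fst).sum = Module.finrank ℝ (ι ⊕ ι → ℝ)) {X : sp ι ℝ}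
    (hX : X ∈ nilpotentOrbit D) : nilpotentOrbit D = adjointOrbit X := by
  classical
  have hdim : ∑ i : D.rows.ToType, i.1.1 = Module.finrank ℝ (ι ⊕ ι → ℝ) :=
    (sum_toType D.rows Prod.fst).trans hD
  obtain ⟨σ, v, h⟩ := (mem_nilpotentOrbit_iff hD X).1 hX
  ext X'
  rw [mem_nilpotentOrbit_iff hD]
  constructor
  · rintro ⟨σ', v', h'⟩
    exact h.mem_adjointOrbit h' hdim
  · intro h'
    obtain ⟨v', h''⟩ := h.of_mem_adjointOrbit h'
    exact ⟨σ, v', h''⟩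

end Orbits

/-! ### Combinatorics of the induced diagrams -/

namespace SignedYoungDiagram

theorem rowBoxes_add (row : ℕ × ℤˣ) : rowBoxes 1 row + rowBoxes (-1) row = row.1 := by
  have h : (1 : ℤˣ) ≠ -1 := by decide
  rcases Int.units_eq_one_or row.2 with h1 | h1
  · rw [rowBoxes, rowBoxes, h1, if_pos rfl, if_neg h]
    omega
  · rw [rowBoxes, rowBoxes, h1, if_pos rfl, if_neg h.symm]
    omega

theorem IsSymplectic.sum_length {D : SignedYoungDiagram} {n : ℕ} (hD : D.IsSymplectic n) :
    (D.rows.map Prod.fst).sum = 2 * n := by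
  have : (D.rows.map Prod.fst).sum = D.boxes 1 + D.boxes (-1) := by
    rw [boxes, boxes, ← Multiset.sum_map_add]
    exact congrArg _ (Multiset.map_congr rfl fun row _ => (rowBoxes_add row).symm)
  rw [this, hD.1, hD.2.1, two_mul]

theorem rowBoxes_extendRow (ε : ℤˣ) (row : ℕ × ℤˣ) :
    rowBoxes ε (extendRow row) = rowBoxes ε row + 1 := by
  obtain ⟨l, δ⟩ := row
  simp only [rowBoxes, extendRow]
  rcases Nat.even_or_odd l with he | ho
  · obtain ⟨p, rfl⟩ := he
    split_ifs <;> omega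
  · rw [if_neg (Nat.not_even_iff_odd.2 ho)]
    split_ifs <;> omega

theorem extendRow_injective : Function.Injective extendRow := by
  rintro ⟨l, δ⟩ ⟨l', δ'⟩ h
  simp only [extendRow, Prod.mk.injEq, Nat.add_right_cancel_iff] at h
  obtain ⟨rfl, h⟩ := h
  split_ifs at h
  · rw [neg_inj.1 h]
  · rw [h]

theorem count_map_extendRow_odd (s : Multiset (ℕ × ℤˣ)) {l : ℕ} (hl : Odd l) (ε : ℤˣ) :
    (s.map extendRow).count (l, ε) = if 2 ≤ l then s.count (l - 2, ε) else 0 := by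
  split_ifs with h2
  · have : (l, ε) = extendRow (l - 2, ε) := by
      have : ¬ Even (l - 2) := by
        rw [Nat.not_even_iff_odd]
        exact Nat.Odd.sub_even h2 hl even_two
      simp [extendRow, this, Nat.sub_add_cancel h2]
    rw [this, Multiset.count_map_eq_count' _ _ extendRow_injective]
  · rw [Multiset.count_eq_zero, Multiset.mem_map]
    rintro ⟨row, -, h⟩
    have := congrArg Prod.fst h
    simp only [extendRow] at this
    omega

theorem IsSymplectic.induce {S : SignedYoungDiagram} {m k j : ℕ} (hS : S.IsSymplectic m)
    (hj : j + S.rows.card ≤ k) : (S.induce k j).IsSymplectic (m + k) := by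
  have hb : ∀ ε, (S.induce k j).boxes ε = S.boxes ε + k := by
    intro ε
    have h2 : ∀ δ, rowBoxes ε (2, δ) = 1 := fun δ => by simp [rowBoxes]
    simp only [boxes, SignedYoungDiagram.induce, Multiset.map_add, Multiset.sum_add,
      Multiset.map_map, Function.comp_def, rowBoxes_extendRow, Multiset.map_replicate, h2,
      Multiset.sum_replicate, Multiset.sum_map_add, Multiset.map_const', smul_eq_mul]
    omega
  refine ⟨by rw [hb, hS.1], by rw [hb, hS.2.1], fun l hl => ?_⟩
  have h2 : ∀ ε δ : ℤˣ, (2, δ) ≠ (l, ε) := by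
    rintro ε δ h
    rw [← (Prod.mk.inj h).1] at hl
    exact absurd hl (by decide)
  simp only [SignedYoungDiagram.induce, Multiset.count_add, count_map_extendRow_odd _ hl,
    Multiset.count_replicate, h2, if_false]
  split_ifs with h
  · rw [hS.2.2 _ (Nat.Odd.sub_even h hl even_two)]
  · rfl

theorem card_induce {S : SignedYoungDiagram} {k j : ℕ} (hj : j + S.rows.card ≤ k) :
    (S.induce k j).rows.card = k := by
  simp only [induce, Multiset.card_add, Multiset.card_map, Multiset.card_replicate]
  omega

/-- This is where j becomes visible: a new row contributes 1 if it starts with + and -1 if it starts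
with -. -/
theorem signature_induce {S : SignedYoungDiagram} {k j : ℕ} (hj : j + S.rows.card ≤ k) :
    ((S.induce k j).rows.map rowSignature).sum =
      (S.rows.map (rowSignature ∘ extendRow)).sum + (k - S.rows.card) - 2 * j := by
  have h1 : rowSignature (2, 1) = 1 := by simp [rowSignature]
  have h2 : rowSignature (2, -1) = -1 := by simp [rowSignature]
  simp only [induce, Multiset.map_add, Multiset.sum_add, Multiset.map_map, Multiset.map_replicate,
    Multiset.sum_replicate, h1, h2, nsmul_eq_mul]
  rw [Nat.sub_sub, Nat.cast_sub (by omega)]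
  push_cast
  ring

open Classical in
-- Rows of odd length l with signs + and - have the same multiplicity, so the c-th copy of one is
-- matched with the c-th copy of the other.
theorem IsSymplectic.exists_involution {D : SignedYoungDiagram} {n : ℕ} (hD : D.IsSymplectic n) :
    ∃ σ : D.rows.ToType → D.rows.ToType, Function.Involutive σ ∧ (∀ i, Even i.1.1 → σ i = i) ∧
      ∀ i, Odd i.1.1 → (σ i).1.1 = i.1.1 ∧ (σ i).1.2 = -i.1.2 := by
  let flip : ℕ × ℤˣ → ℕ × ℤˣ := fun x => (x.1, if Even x.1 then x.2 else -x.2)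
  have hflip : ∀ x, flip (flip x) = x := by
    rintro ⟨l, ε⟩
    simp only [flip]
    split_ifs <;> simp
  have hcount : ∀ x, D.rows.count x = D.rows.count (flip x) := by
    rintro ⟨l, ε⟩
    by_cases he : Even l
    · simp [flip, he]
    · have := hD.2.2 l (Nat.not_even_iff_odd.1 he)
      rcases Int.units_eq_one_or ε with rfl | rfl
      · simpa [flip, he] using this
      · simpa [flip, he] using this.symm
  have hext : ∀ i j : D.rows.ToType, i.1 = j.1 → i.2.1 = j.2.1 → i = j := by
    rintro ⟨x, k⟩ ⟨y, k'⟩ h h'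
    obtain rfl : x = y := h
    obtain rfl : k = k' := Fin.ext h'
    rfl
  refine ⟨fun i => ⟨flip i.1, Fin.cast (hcount i.1) i.2⟩, fun i => hext _ _ (hflip i.1) rfl,
    fun i hi => hext _ _ ?_ rfl, fun i hi => ⟨rfl, ?_⟩⟩
  · simp [flip, hi]
  · simp [flip, Nat.not_even_iff_odd.2 hi]

end SignedYoungDiagram

/-! ### Nonemptiness of the orbits -/

section Existence

variable {ι : Type} [Fintype ι] [DecidableEq ι]

/-- A family with a fixed-point-free involution exchanging signs can be indexed by the standard
symplectic basis. -/
theorem exists_symplectic_equiv {B : Type*} [Fintype B] [DecidableEq B] (τ : B → B)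
    (hτ : Function.Involutive τ) (c : B → ℤˣ) (hc : ∀ β, c (τ β) = -c β)
    (hcard : Fintype.card B = 2 * Fintype.card ι) :
    ∃ e : B ≃ ι ⊕ ι, ∀ β γ, symplForm (Pi.single (e β) 1) (Pi.single (e γ) 1) =
      if γ = τ β then ((c β : ℤ) : ℝ) else 0 := by
  have h11 : (1 : ℤˣ) ≠ -1 := by decide
  have hτc : ∀ β, c β ≠ 1 ↔ c (τ β) = 1 := by
    intro β
    rw [hc, neg_eq_iff_eq_neg]
    exact ⟨(Int.units_eq_one_or _).resolve_left, fun h h' => h11 (h'.symm.trans h)⟩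
  let t : {β // ¬ c β = 1} ≃ {β // c β = 1} :=
    { toFun := fun β => ⟨τ β, (hτc β).1 β.2⟩
      invFun := fun β => ⟨τ β, (hτc _).2 (by rw [hτ]; exact β.2)⟩
      left_inv := fun β => Subtype.ext (hτ β)
      right_inv := fun β => Subtype.ext (hτ β) }
  have hP : Fintype.card {β // c β = 1} = Fintype.card ι := by
    have h1 := Fintype.card_congr (Equiv.sumCompl fun β => c β = 1)
    rw [Fintype.card_sum, Fintype.card_congr t] at h1
    omega
  let f : {β // c β = 1} ≃ ι := Fintype.equivOfCardEq hP
  let e : B ≃ ι ⊕ ι := (Equiv.sumCompl fun β => c β = 1).symm.trans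
    (Equiv.sumCongr f (t.trans f))
  have hl : ∀ β (h : c β = 1), e β = Sum.inl (f ⟨β, h⟩) := fun β h => by
    simp [e, Equiv.sumCompl_symm_apply_of_pos (p := fun β => c β = 1) h]
  have hr : ∀ β (h : ¬ c β = 1), e β = Sum.inr (f ⟨τ β, (hτc β).1 h⟩) := fun β h => by
    simp [e, t, Equiv.sumCompl_symm_apply_of_neg (p := fun β => c β = 1) h]
  refine ⟨e, fun β γ => ?_⟩
  by_cases hβ : c β = 1
  · by_cases hγ : c γ = 1
    · rw [hl β hβ, hl γ hγ, if_neg]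
      · simp [symplForm]
      · rintro rfl
        rw [hc, hβ] at hγ
        exact h11 hγ.symm
    · rw [hl β hβ, hr γ hγ]
      have : τ γ = β ↔ γ = τ β := ⟨fun h => by rw [← h, hτ], fun h => by rw [h, hτ]⟩
      by_cases hγβ : γ = τ β <;>
        simp [symplForm, Pi.single_apply, hβ, f.injective.eq_iff, hγβ, this, hτ β]
  · have hβ' : c β = -1 := (Int.units_eq_one_or _).resolve_left hβ
    by_cases hγ : c γ = 1
    · rw [hr β hβ, hl γ hγ]
      by_cases hγβ : γ = τ β <;>
        simp [symplForm, Pi.single_apply, hβ', f.injective.eq_iff, hγβ]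
    · rw [hr β hβ, hr γ hγ, if_neg]
      · simp [symplForm]
      · rintro rfl
        exact hγ ((hτc β).1 hβ)

/-- The prescribed Gram matrix on boxes is a signed pairing `τ` with `c (τ β) = -c β`, so the boxes
can be identified with the standard symplectic basis; the shift along rows is then skew. -/
theorem nilpotentOrbit_nonempty {D : SignedYoungDiagram} (hD : D.IsSymplectic (Fintype.card ι)) :
    (nilpotentOrbit D : Set (sp ι ℝ)).Nonempty := by
  classical
  obtain ⟨σ, hinv, heven, hodd⟩ := hD.exists_involution
  have hl : ∀ i, (σ i).1.1 = i.1.1 := by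
    intro i
    rcases Nat.even_or_odd i.1.1 with he | ho
    · rw [heven i he]
    · exact (hodd i ho).1
  let τ : (Σ i : D.rows.ToType, Fin i.1.1) → (Σ i : D.rows.ToType, Fin i.1.1) := fun β =>
    ⟨σ β.1, ⟨β.1.1.1 - 1 - β.2, by have := β.2.2; rw [hl]; omega⟩⟩
  have hext : ∀ β γ : (Σ i : D.rows.ToType, Fin i.1.1), β.1 = γ.1 → β.2.1 = γ.2.1 → β = γ := by
    rintro ⟨i, a⟩ ⟨j, b⟩ h h'
    obtain rfl : i = j := h
    obtain rfl : a = b := Fin.ext h'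
    rfl
  have hτ : Function.Involutive τ := by
    intro β
    refine hext _ _ (hinv _) ?_
    have := β.2.2
    change (σ β.1).1.1 - 1 - (β.1.1.1 - 1 - β.2) = β.2
    rw [hl]
    omega
  let c : (Σ i : D.rows.ToType, Fin i.1.1) → ℤˣ := fun β =>
    (-1) ^ (β.1.1.1 - 1 - β.2) * β.1.1.2
  have hc : ∀ β, c (τ β) = -c β := by
    intro β
    obtain ⟨p, hp⟩ : ∃ p, β.1.1.1 = β.2 + p + 1 := ⟨β.1.1.1 - β.2 - 1, by have := β.2.2; omega⟩
    have e1 : β.1.1.1 - 1 - β.2 = p := by omega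
    have e2 : (σ β.1).1.1 - 1 - (β.1.1.1 - 1 - β.2) = β.2 := by rw [hl]; omega
    change (-1) ^ ((σ β.1).1.1 - 1 - (β.1.1.1 - 1 - β.2)) * (σ β.1).1.2 =
      -((-1) ^ (β.1.1.1 - 1 - β.2) * β.1.1.2)
    rw [e2, e1]
    rcases Nat.even_or_odd β.1.1.1 with he | ho
    · rw [heven _ he]
      rcases Nat.even_or_odd β.2.1 with h1 | h1 <;> rcases Nat.even_or_odd p with h2 | h2
      · exact absurd he (by rw [hp, Nat.not_even_iff_odd]; exact (h1.add h2).add_one)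
      · simp [h1.neg_one_pow, h2.neg_one_pow]
      · simp [h1.neg_one_pow, h2.neg_one_pow]
      · exact absurd he (by rw [hp, Nat.not_even_iff_odd]; exact (h1.add_odd h2).add_one)
    · rw [(hodd _ ho).2]
      rcases Nat.even_or_odd β.2.1 with h1 | h1 <;> rcases Nat.even_or_odd p with h2 | h2
      · simp [h1.neg_one_pow, h2.neg_one_pow]
      · exact absurd ho (by rw [hp, Nat.not_odd_iff_even]; exact (h1.add_odd h2).add_one)
      · exact absurd ho (by rw [hp, Nat.not_odd_iff_even]; exact (h1.add_even h2).add_one)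
      · simp [h1.neg_one_pow, h2.neg_one_pow]
  have hcard : Fintype.card (Σ i : D.rows.ToType, Fin i.1.1) = 2 * Fintype.card ι := by
    rw [← hD.sum_length, ← sum_toType D.rows Prod.fst, Fintype.card_sigma]
    simp only [Fintype.card_fin]
  obtain ⟨e, he⟩ := exists_symplectic_equiv τ hτ c hc hcard
  let b : Module.Basis (Σ i : D.rows.ToType, Fin i.1.1) ℝ (ι ⊕ ι → ℝ) :=
    (Pi.basisFun ℝ (ι ⊕ ι)).reindex e.symm
  have hgram : ∀ (i i' : D.rows.ToType) (a : Fin i.1.1) (a' : Fin i'.1.1),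
      symplForm (b ⟨i, a⟩) (b ⟨i', a'⟩) =
        if i' = σ i ∧ a.1 + a'.1 + 1 = i.1.1 then (-1) ^ a'.1 * ((i.1.2 : ℤ) : ℝ) else 0 := by
    intro i i' a a'
    simp only [b, Module.Basis.reindex_apply, Equiv.symm_symm, Pi.basisFun_apply, he]
    have ha := a.2
    have ha' := a'.2
    by_cases hi : i' = σ i ∧ a.1 + a'.1 + 1 = i.1.1
    · have h2 : i.1.1 - 1 - a = a' := by omega
      rw [if_pos hi, if_pos (hext _ _ hi.1 h2.symm)]
      simp [c, h2]
    · rw [if_neg hi, if_neg]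
      intro h
      refine hi ⟨congrArg Sigma.fst h, ?_⟩
      have : a'.1 = i.1.1 - 1 - a := congrArg (fun β => β.2.1) h
      omega
  let T : Module.End ℝ (ι ⊕ ι → ℝ) := b.constr ℝ fun β =>
    if h : β.2.1 + 1 < β.1.1.1 then b ⟨β.1, ⟨β.2.1 + 1, h⟩⟩ else 0
  have hTb : ∀ β, T (b β) = if h : β.2.1 + 1 < β.1.1.1 then b ⟨β.1, ⟨β.2.1 + 1, h⟩⟩ else 0 :=
    fun β => Module.Basis.constr_basis b ℝ _ β
  have hT : ∀ u v, symplBilin ι (T u) v = -symplBilin ι u (T v) := by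
    suffices h : (symplBilin ι).compl₁₂ T LinearMap.id = -(symplBilin ι).compl₁₂ LinearMap.id T from
      fun u v => LinearMap.congr_fun₂ h u v
    refine b.ext fun β => b.ext fun γ => ?_
    obtain ⟨i, a⟩ := β
    obtain ⟨i', a'⟩ := γ
    simp only [LinearMap.compl₁₂_apply, LinearMap.neg_apply, LinearMap.id_apply, hTb]
    have ha := a.2
    have ha' := a'.2
    by_cases hi : i' = σ i ∧ a.1 + 1 + a'.1 + 1 = i.1.1
    · have hl' : i'.1.1 = i.1.1 := by rw [hi.1, hl]
      rw [dif_pos (by omega), dif_pos (by omega), symplBilin_apply, symplBilin_apply, hgram, hgram,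
        if_pos hi, if_pos ⟨hi.1, by simp only; omega⟩]
      simp only [pow_succ]
      ring
    · have h1 : symplBilin ι (if h : a.1 + 1 < i.1.1 then b ⟨i, ⟨a.1 + 1, h⟩⟩ else 0)
          (b ⟨i', a'⟩) = 0 := by
        split_ifs with h
        · rw [symplBilin_apply, hgram, if_neg hi]
        · simp
      have h2 : symplBilin ι (b ⟨i, a⟩)
          (if h : a'.1 + 1 < i'.1.1 then b ⟨i', ⟨a'.1 + 1, h⟩⟩ else 0) = 0 := by
        split_ifs with h
        · rw [symplBilin_apply, hgram, if_neg]
          rintro ⟨h3, h4⟩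
          exact hi ⟨h3, by simp only at h4; omega⟩
        · exact map_zero _
      rw [h1, h2, neg_zero]
  obtain ⟨X, hX⟩ := exists_spEnd_eq T hT
  refine ⟨X, σ, b, hinv, heven, hodd, fun i a => ?_, hgram⟩
  rw [← spEnd_apply, hX, hTb]

end Existence

/-! ### The parabolic subalgebra in adapted coordinates -/

section Frame

variable {ι κ : Type} [Fintype ι] [DecidableEq ι] [Fintype κ] [DecidableEq κ]

/-- The vector with components `x`, `y` in the two halves of the hyperbolic space of `κ` and `w` in
the symplectic space of `ι`. -/
def frameVec (x y : κ → ℝ) (w : ι ⊕ ι → ℝ) : (κ ⊕ ι) ⊕ (κ ⊕ ι) → ℝ :=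
  Sum.elim (Sum.elim x (w ∘ Sum.inl)) (Sum.elim y (w ∘ Sum.inr))

omit [Fintype ι] [DecidableEq ι] [Fintype κ] [DecidableEq κ] in
theorem exists_frameVec (v : (κ ⊕ ι) ⊕ (κ ⊕ ι) → ℝ) : ∃ x y w, v = frameVec x y w := by
  refine ⟨fun p => v (Sum.inl (Sum.inl p)), fun p => v (Sum.inr (Sum.inl p)),
    Sum.elim (fun i => v (Sum.inl (Sum.inr i))) (fun i => v (Sum.inr (Sum.inr i))), ?_⟩
  ext ((p | i) | (p | i)) <;> rfl

omit [DecidableEq ι] [DecidableEq κ] in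
theorem symplBilin_frameVec (x y : κ → ℝ) (w : ι ⊕ ι → ℝ) (x' y' : κ → ℝ) (w' : ι ⊕ ι → ℝ) :
    symplBilin (κ ⊕ ι) (frameVec x y w) (frameVec x' y' w') =
      (x ⬝ᵥ y' - y ⬝ᵥ x') + symplBilin ι w w' := by
  simp [symplForm, frameVec, dotProduct]
  ring

theorem spEnd_leviEmbed (Y : sp ι ℝ) (x y : κ → ℝ) (w : ι ⊕ ι → ℝ) :
    spEnd (leviEmbed (0 : Matrix κ κ ℝ) Y) (frameVec x y w) = frameVec 0 0 (spEnd Y w) := by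
  obtain ⟨P, Q, R, T, hY⟩ : ∃ P Q R T, (Y : Matrix (ι ⊕ ι) (ι ⊕ ι) ℝ) =
    Matrix.fromBlocks P Q R T := ⟨_, _, _, _, (Matrix.fromBlocks_toBlocks _).symm⟩
  rw [spEnd_apply, spEnd_apply]
  simp only [leviEmbed, frameVec, hY, Matrix.fromBlocks_mulVec, Matrix.toBlocks_fromBlocks₁₁,
    Matrix.toBlocks_fromBlocks₁₂, Matrix.toBlocks_fromBlocks₂₁, Matrix.toBlocks_fromBlocks₂₂]
  ext ((p | i) | (p | i)) <;> simp [Function.comp_def]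

/-- Vectors adapted to an isotropic subspace `U`: a basis `u` of `U`, a dual isotropic family `u'`
and an isometric embedding `ρ` of a complement of `U` in its orthogonal. -/
structure IsAdaptedFrame (U : Submodule ℝ ((κ ⊕ ι) ⊕ (κ ⊕ ι) → ℝ))
    (u u' : κ → (κ ⊕ ι) ⊕ (κ ⊕ ι) → ℝ)
    (ρ : (ι ⊕ ι → ℝ) →ₗ[ℝ] ((κ ⊕ ι) ⊕ (κ ⊕ ι) → ℝ)) : Prop where
  left : ∀ p q, symplBilin _ (u p) (u q) = 0
  right : ∀ p q, symplBilin _ (u' p) (u' q) = 0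
  dual : ∀ p q, symplBilin _ (u p) (u' q) = if p = q then 1 else 0
  embed_left : ∀ w p, symplBilin _ (ρ w) (u p) = 0
  embed_right : ∀ w p, symplBilin _ (ρ w) (u' p) = 0
  embed : ∀ w w', symplBilin _ (ρ w) (ρ w') = symplBilin _ w w'
  span : U = Submodule.span ℝ (Set.range u)
  perp : ∀ x, (∀ p, symplBilin _ (u p) x = 0) → ∃ w, x - ρ w ∈ U
  levi_left : ∀ Y p, spEnd (leviEmbed (0 : Matrix κ κ ℝ) Y) (u p) = 0
  levi_right : ∀ Y p, spEnd (leviEmbed (0 : Matrix κ κ ℝ) Y) (u' p) = 0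
  levi_embed : ∀ Y w, spEnd (leviEmbed (0 : Matrix κ κ ℝ) Y) (ρ w) = ρ (spEnd Y w)

/-- The embedding of the symplectic space of `ι`. -/
def frameEmbed (κ ι : Type) : (ι ⊕ ι → ℝ) →ₗ[ℝ] ((κ ⊕ ι) ⊕ (κ ⊕ ι) → ℝ) where
  toFun w := frameVec 0 0 w
  map_add' w w' := by ext ((p | i) | (p | i)) <;> simp [frameVec]
  map_smul' c w := by ext ((p | i) | (p | i)) <;> simp [frameVec]

theorem isAdaptedFrame_left : IsAdaptedFrame (isotropicLeft κ ι)
    (fun p => frameVec (Pi.single p 1) 0 0) (fun p => frameVec 0 (Pi.single p 1) 0)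
    (frameEmbed κ ι) where
  left p q := by simp [symplBilin_frameVec, -symplBilin_apply]
  right p q := by simp [symplBilin_frameVec, -symplBilin_apply]
  dual p q := by simp [symplBilin_frameVec, -symplBilin_apply, Pi.single_apply, eq_comm]
  embed_left w p := by simp [frameEmbed, symplBilin_frameVec, -symplBilin_apply]
  embed_right w p := by simp [frameEmbed, symplBilin_frameVec, -symplBilin_apply]
  embed w w' := by simp [frameEmbed, symplBilin_frameVec, -symplBilin_apply]
  span := by
    apply le_antisymm
    · intro v hv
      obtain ⟨x, y, w, rfl⟩ := exists_frameVec v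
      rw [Submodule.mem_span_range_iff_exists_fun]
      refine ⟨x, ?_⟩
      ext ((p | i) | (p | i))
      · simp [frameVec, Finset.sum_apply, Pi.single_apply]
      · simpa [frameVec, Finset.sum_apply] using (hv.1 i).symm
      · simpa [frameVec, Finset.sum_apply] using (hv.2 (Sum.inl p)).symm
      · simpa [frameVec, Finset.sum_apply] using (hv.2 (Sum.inr i)).symm
    · rw [Submodule.span_le]
      rintro _ ⟨p, rfl⟩
      exact ⟨fun i => rfl, by rintro (p | i) <;> rfl⟩
  perp v hv := by
    obtain ⟨x, y, w, rfl⟩ := exists_frameVec v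
    have hy : y = 0 := by
      ext p
      simpa [symplBilin_frameVec, -symplBilin_apply] using hv p
    refine ⟨w, fun i => ?_, ?_⟩
    · simp [frameEmbed, frameVec]
    · rintro (p | i) <;> simp [frameEmbed, frameVec, hy]
  levi_left Y p := by
    rw [spEnd_leviEmbed, map_zero]
    ext ((p | i) | (p | i)) <;> rfl
  levi_right Y p := by
    rw [spEnd_leviEmbed, map_zero]
    ext ((p | i) | (p | i)) <;> rfl
  levi_embed Y w := spEnd_leviEmbed _ _ _ _

theorem isAdaptedFrame_right : IsAdaptedFrame (isotropicRight κ ι)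
    -- The minus sign in the second family compensates the exchange of the two halves, so that
    -- `dual` holds with value +1.
    (fun p => frameVec 0 (Pi.single p 1) 0) (fun p => frameVec (-Pi.single p 1) 0 0)
    (frameEmbed κ ι) where
  left p q := by simp [symplBilin_frameVec, -symplBilin_apply]
  right p q := by simp [symplBilin_frameVec, -symplBilin_apply]
  dual p q := by simp [symplBilin_frameVec, -symplBilin_apply, Pi.single_apply, eq_comm]
  embed_left w p := by simp [frameEmbed, symplBilin_frameVec, -symplBilin_apply]
  embed_right w p := by simp [frameEmbed, symplBilin_frameVec, -symplBilin_apply]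
  embed w w' := by simp [frameEmbed, symplBilin_frameVec, -symplBilin_apply]
  span := by
    apply le_antisymm
    · intro v hv
      obtain ⟨x, y, w, rfl⟩ := exists_frameVec v
      rw [Submodule.mem_span_range_iff_exists_fun]
      refine ⟨y, ?_⟩
      ext ((p | i) | (p | i))
      · simpa [frameVec, Finset.sum_apply] using (hv.2 (Sum.inl p)).symm
      · simpa [frameVec, Finset.sum_apply] using (hv.2 (Sum.inr i)).symm
      · simp [frameVec, Finset.sum_apply, Pi.single_apply]
      · simpa [frameVec, Finset.sum_apply] using (hv.1 i).symm
    · rw [Submodule.span_le]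
      rintro _ ⟨p, rfl⟩
      exact ⟨fun i => rfl, by rintro (p | i) <;> rfl⟩
  perp v hv := by
    obtain ⟨x, y, w, rfl⟩ := exists_frameVec v
    have hx : x = 0 := by
      ext p
      simpa [symplBilin_frameVec, -symplBilin_apply] using hv p
    refine ⟨w, fun i => ?_, ?_⟩
    · simp [frameEmbed, frameVec]
    · rintro (p | i) <;> simp [frameEmbed, frameVec, hx]
  levi_left Y p := by
    rw [spEnd_leviEmbed, map_zero]
    ext ((p | i) | (p | i)) <;> rfl
  levi_right Y p := by
    rw [spEnd_leviEmbed, map_zero]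
    ext ((p | i) | (p | i)) <;> rfl
  levi_embed Y w := spEnd_leviEmbed _ _ _ _

theorem spEnd_add (X Y : sp ι ℝ) : spEnd (X + Y) = spEnd X + spEnd Y := by
  simp [spEnd]

theorem spEnd_smul (c : ℝ) (X : sp ι ℝ) : spEnd (c • X) = c • spEnd X := by
  simp [spEnd]

namespace IsAdaptedFrame

variable {U : Submodule ℝ ((κ ⊕ ι) ⊕ (κ ⊕ ι) → ℝ)} {u u' : κ → (κ ⊕ ι) ⊕ (κ ⊕ ι) → ℝ}
  {ρ : (ι ⊕ ι → ℝ) →ₗ[ℝ] ((κ ⊕ ι) ⊕ (κ ⊕ ι) → ℝ)}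

theorem mem (h : IsAdaptedFrame U u u' ρ) (p : κ) : u p ∈ U := by
  rw [h.span]
  exact Submodule.subset_span ⟨p, rfl⟩

theorem forall_mem (h : IsAdaptedFrame U u u' ρ) {M : Type*} [AddCommGroup M] [Module ℝ M]
    (T : ((κ ⊕ ι) ⊕ (κ ⊕ ι) → ℝ) →ₗ[ℝ] M) (hT : ∀ p, T (u p) = 0) : ∀ x ∈ U, T x = 0 := by
  have : U ≤ LinearMap.ker T := by
    rw [h.span, Submodule.span_le]
    rintro _ ⟨p, rfl⟩
    exact hT p
  exact fun x hx => this hx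

theorem embed_perp (h : IsAdaptedFrame U u u' ρ) (w : ι ⊕ ι → ℝ) :
    ∀ x ∈ U, symplBilin _ x (ρ w) = 0 := fun x hx => by
  rw [symplBilin_neg_comm, h.forall_mem (symplBilin _ (ρ w)) (h.embed_left w) x hx, neg_zero]

theorem finrank_eq (h : IsAdaptedFrame U u u' ρ) : Module.finrank ℝ U = Fintype.card κ := by
  rw [h.span, finrank_span_eq_card (linearIndependent_of_bilin_dual u u' (fun _ => 1)
    (fun _ => one_ne_zero) h.dual)]

/-- The orthogonal of `U` is `U` plus the image of `ρ`, so the nilradical conditions need testing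
only on these two; the values on `u'` are constrained by skewness alone. -/
theorem mem_add_nilradical_iff (h : IsAdaptedFrame U u u' ρ) (O : Set (sp ι ℝ))
    (X : sp (κ ⊕ ι) ℝ) :
    X ∈ Set.image2 (· + ·) (Set.image2 leviEmbed {(0 : Matrix κ κ ℝ)} O) (nilradicalOf U) ↔
      ∃ Y ∈ O, (∀ x ∈ U, spEnd X x = 0) ∧ ∀ w, spEnd X (ρ w) - ρ (spEnd Y w) ∈ U := by
  constructor
  · rintro ⟨_, ⟨_, rfl, Y, hY, rfl⟩, N, hN, rfl⟩
    refine ⟨Y, hY, fun x hx => ?_, fun w => ?_⟩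
    · have h1 := h.forall_mem (spEnd (leviEmbed 0 Y)) (h.levi_left Y) x hx
      have h2 : spEnd N x = 0 := by rw [spEnd_apply]; exact hN.1 x hx
      simp only [spEnd_add, LinearMap.add_apply, h1, h2, add_zero]
    · have h2 : spEnd N (ρ w) ∈ U := by
        rw [spEnd_apply]
        exact hN.2 _ fun x hx => h.embed_perp w x hx
      simpa only [spEnd_add, LinearMap.add_apply, h.levi_embed, add_sub_cancel_left] using h2
  · rintro ⟨Y, hY, h1, h2⟩
    have hN : ∀ x, spEnd (X - leviEmbed 0 Y) x = spEnd X x - spEnd (leviEmbed 0 Y) x := by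
      intro x
      have := spEnd_add (X - leviEmbed 0 Y) (leviEmbed 0 Y)
      rw [sub_add_cancel] at this
      rw [this, LinearMap.add_apply, add_sub_cancel_right]
    have hU : ∀ x ∈ U, spEnd (X - leviEmbed 0 Y) x = 0 := fun x hx => by
      rw [hN, h1 x hx, h.forall_mem (spEnd (leviEmbed 0 Y)) (h.levi_left Y) x hx, sub_zero]
    refine ⟨_, ⟨_, rfl, Y, hY, rfl⟩, X - leviEmbed 0 Y, ⟨fun x hx => ?_, fun x hx => ?_⟩,
      add_sub_cancel _ _⟩
    · rw [← spEnd_apply]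
      exact hU x hx
    · rw [← spEnd_apply]
      obtain ⟨w, hw⟩ := h.perp x fun p => hx _ (h.mem p)
      have h3 := hU _ hw
      rw [map_sub, sub_eq_zero] at h3
      rw [h3, hN, h.levi_embed]
      exact h2 w

end IsAdaptedFrame

end Frame

/-! ### Kernel and range of a skew endomorphism -/

section Kernel

variable {V : Type*} [AddCommGroup V] [Module ℝ V] [FiniteDimensional ℝ V]
  {Ω : LinearMap.BilinForm ℝ V} {X : Module.End ℝ V}

/-- Definite subspaces for `Ω (X x) x` bound the dimension of the kernel of `X`. -/
theorem finrank_add_finrank_ker_le (hX : ∀ x y, Ω (X x) y = -Ω x (X y)) {F G : Submodule ℝ V}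
    (hF : ∀ x ∈ F, x ≠ 0 → 0 < Ω (X x) x) (hG : ∀ x ∈ G, x ≠ 0 → Ω (X x) x < 0) :
    Module.finrank ℝ F + Module.finrank ℝ G + Module.finrank ℝ (LinearMap.ker X) ≤
      Module.finrank ℝ V := by
  have hdisj : Disjoint G (LinearMap.ker X) := by
    rw [Submodule.disjoint_def]
    intro x hx hx'
    by_contra h0
    have := hG x hx h0
    rw [LinearMap.mem_ker.1 hx'] at this
    simp at this
  have hsum : Module.finrank ℝ (G ⊔ LinearMap.ker X : Submodule ℝ V) =
      Module.finrank ℝ G + Module.finrank ℝ (LinearMap.ker X) := by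
    have := Submodule.finrank_sup_add_finrank_inf_eq G (LinearMap.ker X)
    rwa [hdisj.eq_bot, finrank_bot, add_zero] at this
  rw [add_assoc, ← hsum]
  refine finrank_add_le_of_pos_of_nonpos (fun x => Ω (X x) x) F _ hF ?_
  intro x hx
  obtain ⟨y, hy, z, hz, rfl⟩ := Submodule.mem_sup.1 hx
  rw [LinearMap.mem_ker] at hz
  have h1 : Ω (X y) z = 0 := by rw [hX, hz, map_zero, neg_zero]
  have h2 : Ω (X (y + z)) (y + z) = Ω (X y) y := by
    rw [map_add X, hz, add_zero, map_add, h1, add_zero]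
  rw [h2]
  by_cases h0 : y = 0
  · simp [h0]
  · exact (hG y hy h0).le

/-- By skewness a vector orthogonal to the range of X is in its kernel; then take the double
orthogonal of the range. -/
theorem mem_range_of_perp_ker (hX : ∀ x y, Ω (X x) y = -Ω x (X y))
    (halt : ∀ x y, Ω x y = -Ω y x) (hnd : ∀ x, (∀ y, Ω x y = 0) → x = 0) {z : V}
    (hz : ∀ x, X x = 0 → Ω x z = 0) : ∃ x, X x = z := by
  have hrefl : Ω.IsRefl := fun x y h => by rw [halt, h, neg_zero]
  have hnd' : Ω.Nondegenerate :=
    ⟨hnd, fun y hy => hnd y fun x => by rw [halt, hy, neg_zero]⟩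
  rw [← LinearMap.mem_range, ← LinearMap.BilinForm.orthogonal_orthogonal hnd' hrefl (LinearMap.range X)]
  intro x hx
  refine hz x (hnd _ fun y => ?_)
  rw [hX, halt, hx (X y) ⟨y, rfl⟩, neg_zero, neg_zero]

end Kernel

/-! ### Generic elements of `𝒪_S + 𝔫` and the invariant j -/

section Induction

variable {ι κ : Type} [Fintype ι] [DecidableEq ι] [Fintype κ] [DecidableEq κ]

omit [DecidableEq ι] in
theorem finrank_symplectic_space :
    Module.finrank ℝ (ι ⊕ ι → ℝ) = 2 * Fintype.card ι := by
  simp [two_mul]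

/-- Lifting chains negates every sign, whereas `extendRow` keeps the signs of odd rows. Exchanging
each odd row with its partner under `σ` shows that the multisets agree. -/
theorem map_extendedRow_eq {S : SignedYoungDiagram} {k l : ℕ} {σ : S.rows.ToType → S.rows.ToType}
    (hinv : Function.Involutive σ) (heven : ∀ i, Even i.1.1 → σ i = i)
    (hodd : ∀ i, Odd i.1.1 → (σ i).1.1 = i.1.1 ∧ (σ i).1.2 = -i.1.2) (ε : Fin l → ℤˣ)
    (hl : l + S.rows.card = k) :
    Finset.univ.val.map (extendedRow (fun i : S.rows.ToType => i.1) ε) =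
      (S.induce k (Finset.univ.filter fun a => ε a = -1).card).rows := by
  have h11 : (1 : ℤˣ) ≠ -1 := by decide
  have hext : ∀ i : S.rows.ToType, ((i.1.1 + 2, -i.1.2) : ℕ × ℤˣ) =
      SignedYoungDiagram.extendRow (σ i).1 := by
    intro i
    rcases Nat.even_or_odd i.1.1 with he | ho
    · rw [heven i he, SignedYoungDiagram.extendRow, if_pos he]
    · have := hodd i ho
      rw [SignedYoungDiagram.extendRow, this.1, this.2, if_neg (Nat.not_even_iff_odd.2 ho)]
  have h1 : Finset.univ.val.map (fun i : S.rows.ToType => ((i.1.1 + 2, -i.1.2) : ℕ × ℤˣ)) =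
      S.rows.map SignedYoungDiagram.extendRow := by
    conv_rhs => rw [← Multiset.map_univ_coe S.rows, Multiset.map_map]
    rw [Multiset.map_congr rfl fun i _ => hext i]
    have := Multiset.map_univ_val_equiv (Function.Involutive.toPerm σ hinv)
    conv_rhs => rw [← this, Multiset.map_map]
    rfl
  have h2 : ∀ s : Finset (Fin l), s.val.map (fun a => ((2, ε a) : ℕ × ℤˣ)) =
      Multiset.replicate (s.filter fun a => ε a = -1).card (2, -1) +
        Multiset.replicate (s.card - (s.filter fun a => ε a = -1).card) (2, 1) := by
    intro s
    have h3 : s.card - (s.filter fun a => ε a = -1).card = (s.filter fun a => ¬ ε a = -1).card := by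
      rw [← Finset.card_filter_add_card_filter_not (s := s) (p := fun a => ε a = -1)]
      omega
    rw [h3]
    conv_lhs => rw [← Multiset.filter_add_not (fun a => ε a = -1) s.val, Multiset.map_add]
    congr 1
    · refine (Multiset.eq_replicate).2 ⟨by simp [Finset.card], fun x hx => ?_⟩
      obtain ⟨a, ha, rfl⟩ := Multiset.mem_map.1 hx
      rw [(Multiset.mem_filter.1 ha).2]
    · refine (Multiset.eq_replicate).2 ⟨by simp [Finset.card], fun x hx => ?_⟩
      obtain ⟨a, ha, rfl⟩ := Multiset.mem_map.1 hx
      rw [(Int.units_eq_one_or (ε a)).resolve_right (Multiset.mem_filter.1 ha).2]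
  have h4 : (Finset.univ : Finset (S.rows.ToType ⊕ Fin l)).val =
      Finset.univ.val.map Sum.inl + Finset.univ.val.map Sum.inr := rfl
  rw [h4, Multiset.map_add, Multiset.map_map, Multiset.map_map]
  have h5 : k - S.rows.card = l := by omega
  simp only [SignedYoungDiagram.induce, h5]
  rw [add_assoc]
  refine congrArg₂ (· + ·) h1 ?_
  have := h2 Finset.univ
  rw [Finset.card_univ, Fintype.card_fin] at this
  exact this

variable {S : SignedYoungDiagram}

omit [DecidableEq ι] in
theorem SignedYoungDiagram.IsSymplectic.finrank_eq (hS : S.IsSymplectic (Fintype.card ι)) :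
    (S.rows.map Prod.fst).sum = Module.finrank ℝ (ι ⊕ ι → ℝ) := by
  rw [hS.sum_length, finrank_symplectic_space]

omit [DecidableEq ι] [DecidableEq κ] in
theorem SignedYoungDiagram.IsSymplectic.induce_finrank_eq (hS : S.IsSymplectic (Fintype.card ι))
    {j : ℕ} (hj : j + S.rows.card ≤ Fintype.card κ) :
    ((S.induce (Fintype.card κ) j).rows.map Prod.fst).sum =
      Module.finrank ℝ ((κ ⊕ ι) ⊕ (κ ⊕ ι) → ℝ) := by
  rw [(hS.induce hj).sum_length, finrank_symplectic_space, Fintype.card_sum, add_comm]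

/-- The index of `Ω (X x) x` on the orbits `𝒪_D`, for `D` obtained by induction. -/
theorem exists_index_of_mem_induce (hS : S.IsSymplectic (Fintype.card ι)) {j : ℕ}
    (hj : j + S.rows.card ≤ Fintype.card κ) {X : sp (κ ⊕ ι) ℝ}
    (hX : X ∈ nilpotentOrbit (S.induce (Fintype.card κ) j)) (η : ℝ) (hη : η * η = 1) :
    ∃ F K : Submodule ℝ ((κ ⊕ ι) ⊕ (κ ⊕ ι) → ℝ),
      (∀ x ∈ F, x ≠ 0 → 0 < η * symplBilin _ (spEnd X x) x) ∧
      (∀ x ∈ K, η * symplBilin _ (spEnd X x) x ≤ 0) ∧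
      2 * (Module.finrank ℝ F : ℝ) = Module.finrank ℝ ((κ ⊕ ι) ⊕ (κ ⊕ ι) → ℝ) - Fintype.card κ +
        η * ((S.rows.map (rowSignature ∘ SignedYoungDiagram.extendRow)).sum +
          (Fintype.card κ - S.rows.card) - 2 * j) ∧
      Module.finrank ℝ F + Module.finrank ℝ K = Module.finrank ℝ ((κ ⊕ ι) ⊕ (κ ⊕ ι) → ℝ) := by
  classical
  have hdim := hS.induce_finrank_eq hj
  obtain ⟨σ, v, h⟩ := (mem_nilpotentOrbit_iff hdim X).1 hX
  obtain ⟨F, K, hF, hK, hFd, hFK⟩ := h.exists_index (spEnd_skew X) symplBilin_neg_comm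
    ((sum_toType _ Prod.fst).trans hdim)
    (fun i => (S.induce (Fintype.card κ) j).pos _ (Multiset.coe_mem)) η hη
  refine ⟨F, K, hF, hK, ?_, hFK⟩
  rw [hFd, sum_toType _ rowSignature, SignedYoungDiagram.signature_induce hj, Multiset.card_coe,
    SignedYoungDiagram.card_induce hj]

/-- Apply the index formula with `η = 1` and `η = -1`: the signature terms cancel in the sum,
leaving the dimension minus the number of rows. -/
theorem exists_definite_of_mem_induce (hS : S.IsSymplectic (Fintype.card ι)) {j : ℕ}
    (hj : j + S.rows.card ≤ Fintype.card κ) {X : sp (κ ⊕ ι) ℝ}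
    (hX : X ∈ nilpotentOrbit (S.induce (Fintype.card κ) j)) :
    ∃ F G : Submodule ℝ ((κ ⊕ ι) ⊕ (κ ⊕ ι) → ℝ),
      (∀ x ∈ F, x ≠ 0 → 0 < symplBilin _ (spEnd X x) x) ∧
      (∀ x ∈ G, x ≠ 0 → symplBilin _ (spEnd X x) x < 0) ∧
      2 * (Module.finrank ℝ F : ℝ) = Module.finrank ℝ ((κ ⊕ ι) ⊕ (κ ⊕ ι) → ℝ) - Fintype.card κ +
        ((S.rows.map (rowSignature ∘ SignedYoungDiagram.extendRow)).sum +
          (Fintype.card κ - S.rows.card) - 2 * j) ∧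
      Module.finrank ℝ F + Module.finrank ℝ G + Fintype.card κ =
        Module.finrank ℝ ((κ ⊕ ι) ⊕ (κ ⊕ ι) → ℝ) := by
  obtain ⟨F, -, hF, -, hFd, -⟩ := exists_index_of_mem_induce hS hj hX 1 (by norm_num)
  obtain ⟨G, -, hG, -, hGd, -⟩ := exists_index_of_mem_induce hS hj hX (-1) (by norm_num)
  refine ⟨F, G, fun x hx h0 => by simpa using hF x hx h0, fun x hx h0 => ?_, by linarith, ?_⟩
  · have := hG x hx h0
    linarith
  · have : (Module.finrank ℝ F : ℝ) + Module.finrank ℝ G + Fintype.card κ =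
        Module.finrank ℝ ((κ ⊕ ι) ⊕ (κ ⊕ ι) → ℝ) := by linarith
    exact_mod_cast this

/-- Comparison of indices: a positive definite subspace for an element of one orbit bounds the
index of another one. -/
theorem le_of_pos_definite (hS : S.IsSymplectic (Fintype.card ι)) {j : ℕ} {c : ℝ}
    (hj : j + S.rows.card ≤ Fintype.card κ) {X : sp (κ ⊕ ι) ℝ}
    (hX : X ∈ nilpotentOrbit (S.induce (Fintype.card κ) j)) (η : ℝ) (hη : η * η = 1)
    {F : Submodule ℝ ((κ ⊕ ι) ⊕ (κ ⊕ ι) → ℝ)}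
    (hF : ∀ x ∈ F, x ≠ 0 → 0 < η * symplBilin _ (spEnd X x) x)
    (hFd : 2 * (Module.finrank ℝ F : ℝ) =
      Module.finrank ℝ ((κ ⊕ ι) ⊕ (κ ⊕ ι) → ℝ) - Fintype.card κ +
        η * ((S.rows.map (rowSignature ∘ SignedYoungDiagram.extendRow)).sum +
          (Fintype.card κ - S.rows.card) - 2 * c)) : η * j ≤ η * c := by
  obtain ⟨F', K, -, hK, hFd', hFK⟩ := exists_index_of_mem_induce hS hj hX η hη
  have h1 := finrank_add_le_of_pos_of_nonpos (fun x => η * symplBilin _ (spEnd X x) x) F K hF hK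
  have h2 : (Module.finrank ℝ F : ℝ) ≤ Module.finrank ℝ F' := by
    exact_mod_cast (by omega : Module.finrank ℝ F ≤ Module.finrank ℝ F')
  linarith

theorem nilpotentOrbit_induce_injective (hS : S.IsSymplectic (Fintype.card ι)) {i j : ℕ}
    (hi : i + S.rows.card ≤ Fintype.card κ) (hj : j + S.rows.card ≤ Fintype.card κ)
    {X : sp (κ ⊕ ι) ℝ} (hXi : X ∈ nilpotentOrbit (S.induce (Fintype.card κ) i))
    (hXj : X ∈ nilpotentOrbit (S.induce (Fintype.card κ) j)) : i = j := by
  obtain ⟨F, -, hF, -, hFd, -⟩ := exists_index_of_mem_induce hS hi hXi 1 (by norm_num)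
  obtain ⟨G, -, hG, -, hGd, -⟩ := exists_index_of_mem_induce hS hj hXj 1 (by norm_num)
  have h1 := le_of_pos_definite hS hj hXj 1 (by norm_num) hF hFd
  have h2 := le_of_pos_definite hS hi hXi 1 (by norm_num) hG hGd
  have : (i : ℝ) = j := by linarith
  exact_mod_cast this

variable {U : Submodule ℝ ((κ ⊕ ι) ⊕ (κ ⊕ ι) → ℝ)} {u u' : κ → (κ ⊕ ι) ⊕ (κ ⊕ ι) → ℝ}
  {ρ : (ι ⊕ ι → ℝ) →ₗ[ℝ] ((κ ⊕ ι) ⊕ (κ ⊕ ι) → ℝ)}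

/-- The generic elements of `𝒪_S + 𝔫` lie in the orbits `𝒪_{D^(j)}`. -/
theorem IsAdaptedFrame.exists_mem_induce (h : IsAdaptedFrame U u u' ρ)
    (hS : S.IsSymplectic (Fintype.card ι)) {X : sp (κ ⊕ ι) ℝ}
    {Y : sp ι ℝ} (hY : Y ∈ nilpotentOrbit S) (hXU : ∀ x ∈ U, spEnd X x = 0)
    (hXρ : ∀ w, spEnd X (ρ w) - ρ (spEnd Y w) ∈ U)
    (hker : Module.finrank ℝ (LinearMap.ker (spEnd X)) ≤ Fintype.card κ) :
    ∃ j, j + S.rows.card ≤ Fintype.card κ ∧ X ∈ nilpotentOrbit (S.induce (Fintype.card κ) j) := by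
  classical
  -- Genericity enters only here: `U` is contained in the kernel and has the maximal dimension
  -- allowed.
  have hkerU : U = LinearMap.ker (spEnd X) :=
    Submodule.eq_of_le_of_finrank_le (fun x hx => hXU x hx) (by rw [h.finrank_eq]; exact hker)
  have hperp : ∀ x, spEnd X x = 0 → ∀ w, symplBilin _ x (ρ w) = 0 := fun x hx w =>
    h.embed_perp w x (by rw [hkerU]; exact hx)
  obtain ⟨σ, w, hfam⟩ := (mem_nilpotentOrbit_iff hS.finrank_eq Y).1 hY
  obtain ⟨l, ε, v, hl, hv⟩ := hfam.exists_extension (spEnd_skew X) symplBilin_neg_comm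
    symplBilin_nondegenerate (spEnd_skew Y) symplBilin_nondegenerate
    (fun i => S.pos _ (Multiset.coe_mem)) ((sum_toType _ Prod.fst).trans hS.finrank_eq)
    (k := Fintype.card κ)
    (by rw [finrank_symplectic_space, finrank_symplectic_space, Fintype.card_sum]; ring)
    (by rw [← hkerU, h.finrank_eq]) h.embed hperp
    (fun w => by
      have := hXU _ (hXρ w)
      rwa [map_sub, sub_eq_zero] at this)
    (fun w => mem_range_of_perp_ker (spEnd_skew X) symplBilin_neg_comm symplBilin_nondegenerate
      fun x hx => hperp x hx w)
    (fun x => by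
      obtain ⟨w, hw⟩ := h.perp (spEnd X x) fun p => by
        have := spEnd_skew X (u p) x
        rw [hXU _ (h.mem p), map_zero, LinearMap.zero_apply] at this
        linarith
      exact ⟨w, hXU _ hw⟩)
  rw [Multiset.card_coe] at hl
  have hj : (Finset.univ.filter fun a => ε a = -1).card ≤ l :=
    (Finset.card_le_univ _).trans (by simp)
  refine ⟨(Finset.univ.filter fun a => ε a = -1).card, by omega, ?_⟩
  exact hv.mem_nilpotentOrbit (hS.induce_finrank_eq (by omega))
    (map_extendedRow_eq hfam.invol hfam.even hfam.odd ε hl)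

end Induction

/-! ### Explicit representatives in `Y + 𝔫` -/

section Explicit

variable {ι κ : Type} [Fintype ι] [DecidableEq ι] [Fintype κ] [DecidableEq κ]
  {U : Submodule ℝ ((κ ⊕ ι) ⊕ (κ ⊕ ι) → ℝ)} {u u' : κ → (κ ⊕ ι) ⊕ (κ ⊕ ι) → ℝ}
  {ρ : (ι ⊕ ι → ℝ) →ₗ[ℝ] ((κ ⊕ ι) ⊕ (κ ⊕ ι) → ℝ)} {S : SignedYoungDiagram}

/-- Extending a skew endomorphism of the symplectic space of `ι`, with prescribed values
`ρ (w p) + c p • u p` on the vectors `u' p`. -/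
theorem IsAdaptedFrame.exists_extension (h : IsAdaptedFrame U u u' ρ) (Y : sp ι ℝ)
    (w : κ → ι ⊕ ι → ℝ) (c : κ → ℝ) :
    ∃ X : sp (κ ⊕ ι) ℝ, (∀ x ∈ U, spEnd X x = 0) ∧
      (∀ z, spEnd X (ρ z) - ρ (spEnd Y z) ∈ U) ∧ ∀ p, spEnd X (u' p) = ρ (w p) + c p • u p := by
  let Ω := symplBilin (κ ⊕ ι)
  -- Operators `x ↦ Ω a x • b + Ω b x • a` are skew; with a = `u p` and b = `ρ (w p)` they send `u'
  -- p` to `ρ (w p)`, and the last summand adds `c p • u p`.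
  let N : Module.End ℝ ((κ ⊕ ι) ⊕ (κ ⊕ ι) → ℝ) := ∑ p,
    ((Ω (u p)).smulRight (ρ (w p)) + (Ω (ρ (w p))).smulRight (u p) +
      c p • (Ω (u p)).smulRight (u p))
  have hNx : ∀ x, N x = ∑ p, (Ω (u p) x • ρ (w p) + Ω (ρ (w p)) x • u p +
      c p • Ω (u p) x • u p) := fun x => by
    simp [N, LinearMap.sum_apply]
  have hNsymm : ∀ x y, Ω (N x) y = Ω (N y) x := by
    intro x y
    simp only [hNx, map_sum, map_add, map_smul, LinearMap.sum_apply, LinearMap.add_apply,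
      LinearMap.smul_apply, smul_eq_mul]
    exact Finset.sum_congr rfl fun p _ => by ring
  have hN : ∀ x y, Ω (N x) y = -Ω x (N y) := fun x y => by
    rw [hNsymm]
    exact symplBilin_neg_comm _ _
  obtain ⟨M, hM⟩ := exists_spEnd_eq N hN
  have hul : ∀ p q, Ω (u p) (u q) = 0 := h.left
  have hur : ∀ p q, Ω (u p) (u' q) = if p = q then 1 else 0 := h.dual
  have hρl : ∀ z q, Ω (ρ z) (u q) = 0 := h.embed_left
  have hρr : ∀ z q, Ω (ρ z) (u' q) = 0 := h.embed_right
  have huρ : ∀ p z, Ω (u p) (ρ z) = 0 := fun p z => h.embed_perp z _ (h.mem p)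
  refine ⟨leviEmbed 0 Y + M, ?_, ?_, ?_⟩
  · refine h.forall_mem _ fun q => ?_
    rw [spEnd_add, LinearMap.add_apply, h.levi_left, hM, hNx]
    simp [hul, hρl]
  · intro z
    rw [spEnd_add, LinearMap.add_apply, h.levi_embed, add_sub_cancel_left, hM, hNx]
    refine Submodule.sum_mem _ fun p _ => ?_
    rw [huρ, zero_smul, zero_smul, smul_zero, zero_add, add_zero]
    exact U.smul_mem _ (h.mem p)
  · intro q
    rw [spEnd_add, LinearMap.add_apply, h.levi_right, hM, hNx]
    simp [hur, hρr, Finset.sum_add_distrib, ite_smul]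

/-- Every orbit `𝒪_{D^(j)}` contains an element of `Y + 𝔫`, for every `Y ∈ 𝒪_S`. -/
theorem IsAdaptedFrame.exists_mem_nilpotentOrbit (h : IsAdaptedFrame U u u' ρ)
    (hS : S.IsSymplectic (Fintype.card ι)) {Y : sp ι ℝ} (hY : Y ∈ nilpotentOrbit S) {j : ℕ}
    (hj : j + S.rows.card ≤ Fintype.card κ) :
    ∃ X : sp (κ ⊕ ι) ℝ, (∀ x ∈ U, spEnd X x = 0) ∧
      (∀ z, spEnd X (ρ z) - ρ (spEnd Y z) ∈ U) ∧
      X ∈ nilpotentOrbit (S.induce (Fintype.card κ) j) := by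
  classical
  obtain ⟨σ, w, hfam⟩ := (mem_nilpotentOrbit_iff hS.finrank_eq Y).1 hY
  obtain ⟨l, hl⟩ : ∃ l, l + S.rows.card = Fintype.card κ :=
    ⟨Fintype.card κ - S.rows.card, by omega⟩
  let e : S.rows.ToType ⊕ Fin l ≃ κ := Fintype.equivOfCardEq (by simp [← hl, add_comm])
  let ε : Fin l → ℤˣ := fun a => if a.1 < j then -1 else 1
  have hεcard : (Finset.univ.filter fun a => ε a = -1).card = j := by
    have h11 : (1 : ℤˣ) ≠ -1 := by decide
    have : (Finset.univ.filter fun a => ε a = -1) = Finset.univ.filter fun a : Fin l => a.1 < j := by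
      ext a
      simp only [ε, Finset.mem_filter, Finset.mem_univ, true_and]
      split_ifs with ha <;> simp [ha, h11]
    rw [this, Fin.card_filter_val_lt]
    omega
  -- The `u' p` themselves generate the chains: r of them map to the generators `ρ (w i)`, giving
  -- the extended rows, and each other one maps to `±u p`, giving a row of length two.
  obtain ⟨X, hXU, hXρ, hX⟩ := h.exists_extension Y (fun p => Sum.elim w (fun _ => 0) (e.symm p))
    (fun p => Sum.elim (fun _ => 0) (fun a => ((ε a : ℤ) : ℝ)) (e.symm p))
  have hXi : ∀ i, spEnd X (u' (e (Sum.inl i))) = ρ (w i) := fun i => by simp [hX]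
  have hXa : ∀ a, spEnd X (u' (e (Sum.inr a))) = ((ε a : ℤ) : ℝ) • u (e (Sum.inr a)) := fun a => by
    simp [hX]
  have hXX : ∀ a N, 1 < N → (spEnd X ^ N) (u' (e (Sum.inr a))) = 0 := by
    intro a N hN
    obtain ⟨d, rfl⟩ := Nat.exists_eq_add_of_lt hN
    rw [show 1 + d + 1 = d + 2 by ring, pow_add, Module.End.mul_apply, pow_two,
      Module.End.mul_apply, hXa, map_smul, hXU _ (h.mem _), smul_zero, map_zero]
  have hpow : ∀ i N, (spEnd X ^ (N + 1)) (u' (e (Sum.inl i))) - ρ ((spEnd Y ^ N) (w i)) ∈ U := by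
    intro i N
    induction N with
    | zero => simp [hXi]
    | succ N ih =>
      have h1 := hXU _ ih
      rw [map_sub, sub_eq_zero] at h1
      rw [pow_succ' (spEnd X), Module.End.mul_apply, h1, pow_succ' (spEnd Y), Module.End.mul_apply]
      exact hXρ _
  have hN2 : ∀ i i' N, symplBilin _ ((spEnd X ^ (N + 2)) (u' (e (Sum.inl i))))
      (u' (e (Sum.inl i'))) = if i' = σ i ∧ N + 1 = i.1.1 then -((i.1.2 : ℤ) : ℝ) else 0 := by
    intro i i' N
    have h1 := h.embed_perp (w i') _ (hpow i N)
    rw [map_sub, LinearMap.sub_apply, sub_eq_zero] at h1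
    rw [pow_succ' (spEnd X), Module.End.mul_apply, spEnd_skew, hXi, h1, h.embed, hfam.pair]
    split_ifs <;> simp
  have hlen : ∀ i : S.rows.ToType, 0 < i.1.1 := fun i => S.pos _ Multiset.coe_mem
  have hai : ∀ a i N, symplBilin _ ((spEnd X ^ N) (u' (e (Sum.inr a)))) (u' (e (Sum.inl i))) = 0 := by
    intro a i N
    rcases Nat.lt_or_ge 1 N with h1 | h1
    · rw [hXX a N h1, map_zero, LinearMap.zero_apply]
    · interval_cases N
      · exact h.right _ _
      · rw [pow_one, hXa, map_smul, LinearMap.smul_apply, h.dual, if_neg (by simp), smul_zero]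
  have hv : ChainFamily (symplBilin _) (spEnd X)
      (extendedRow (fun i : S.rows.ToType => i.1) ε) (Sum.map σ id) (fun q => u' (e q)) := by
    refine ⟨?_, ?_, ?_, ?_⟩
    · rintro (i | a)
      · simp [hfam.invol i]
      · simp
    · rintro (i | a) he
      · rw [Sum.map_inl, hfam.even i (by simpa [extendedRow, Nat.even_add] using he)]
      · rfl
    · rintro (i | a) ho
      · have := hfam.odd i (by simpa [extendedRow, Nat.odd_add] using ho)
        simp [extendedRow, this]
      · exact absurd ho (by simp [extendedRow])
    · rintro (i | a) (i' | a') N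
      · have := hlen i
        simp only [extendedRow, Sum.elim_inl, Sum.map_inl, Sum.inl.injEq]
        obtain rfl | rfl | ⟨M, rfl⟩ : N = 0 ∨ N = 1 ∨ ∃ M, N = M + 2 := by
          rcases Nat.lt_or_ge N 2 with h2 | h2
          · omega
          · exact Or.inr (Or.inr ⟨N - 2, by omega⟩)
        · rw [if_neg (by omega)]
          exact h.right _ _
        · rw [if_neg (by omega), pow_one, hXi, h.embed_right]
        · rw [hN2]
          push_cast
          refine if_congr (and_congr_right fun _ => ?_) rfl rfl
          omega
      · simp only [Sum.map_inl, reduceCtorEq, false_and, if_false]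
        rw [symplBilin_neg_comm, bilin_pow_skew (spEnd_skew X), hai, mul_zero, neg_zero]
      · simp only [Sum.map_inr, reduceCtorEq, false_and, if_false]
        exact hai a i' N
      · simp only [extendedRow, Sum.elim_inr, Sum.map_inr, Sum.inr.injEq, id]
        rcases Nat.lt_or_ge 1 N with h1 | h1
        · rw [hXX a N h1, if_neg (by omega), map_zero, LinearMap.zero_apply]
        · interval_cases N
          · rw [if_neg (by omega)]
            exact h.right _ _
          · rw [pow_one, hXa, map_smul, LinearMap.smul_apply, h.dual]
            simp [eq_comm]
  refine ⟨X, hXU, hXρ, hv.mem_nilpotentOrbit (hS.induce_finrank_eq hj) ?_⟩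
  rw [map_extendedRow_eq hfam.invol hfam.even hfam.odd ε hl, hεcard]

end Explicit

/-! ### Openness of definiteness and genericity along a line -/

section Topology

variable {ι : Type} [Fintype ι] [DecidableEq ι]

/-- By homogeneity, positivity needs checking only on the unit sphere of `F`, which is compact, so
it persists for nearby X. -/
theorem isOpen_setOf_pos_definite (F : Submodule ℝ (ι ⊕ ι → ℝ)) (η : ℝ) :
    IsOpen {X : sp ι ℝ | ∀ x ∈ F, x ≠ 0 → 0 < η * symplBilin ι (spEnd X x) x} := by
  have hcont : Continuous fun z : sp ι ℝ × (ι ⊕ ι → ℝ) =>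
      η * symplBilin ι (spEnd z.1 z.2) z.2 := by
    have hm : Continuous fun z : sp ι ℝ × (ι ⊕ ι → ℝ) =>
        (z.1 : Matrix (ι ⊕ ι) (ι ⊕ ι) ℝ).mulVec z.2 :=
      (continuous_subtype_val.comp continuous_fst).matrix_mulVec continuous_snd
    have hmi : ∀ i, Continuous fun z : sp ι ℝ × (ι ⊕ ι → ℝ) =>
        (z.1 : Matrix (ι ⊕ ι) (ι ⊕ ι) ℝ).mulVec z.2 i := fun i => (continuous_apply i).comp hm
    simp only [symplBilin_apply, spEnd_apply, symplForm]
    fun_prop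
  have hK : IsCompact ((F : Set (ι ⊕ ι → ℝ)) ∩ Metric.sphere 0 1) :=
    (isCompact_sphere 0 1).inter_left F.closed_of_finiteDimensional
  have hset : {X : sp ι ℝ | ∀ x ∈ F, x ≠ 0 → 0 < η * symplBilin ι (spEnd X x) x} =
      {X : sp ι ℝ | ∀ x ∈ (F : Set (ι ⊕ ι → ℝ)) ∩ Metric.sphere 0 1,
        0 < η * symplBilin ι (spEnd X x) x} := by
    ext X
    refine ⟨fun h x hx => h x hx.1 (by rintro rfl; simpa using hx.2), fun h x hx h0 => ?_⟩
    have hn : 0 < ‖x‖ := norm_pos_iff.2 h0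
    have := h (‖x‖⁻¹ • x) ⟨F.smul_mem _ hx, by simp [norm_smul, hn.ne']⟩
    rw [map_smul, map_smul, map_smul, LinearMap.smul_apply, smul_eq_mul, smul_eq_mul] at this
    have h2 : η * symplBilin ι (spEnd X x) x =
        ‖x‖ * ‖x‖ * (η * (‖x‖⁻¹ * (‖x‖⁻¹ * symplBilin ι (spEnd X x) x))) := by
      field_simp
    rw [h2]
    positivity
  rw [hset, isOpen_iff_eventually]
  intro X hX
  refine hK.eventually_forall_of_forall_eventually (P := fun (X : sp ι ℝ) x =>
    0 < η * symplBilin ι (spEnd X x) x) fun x hx => ?_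
  exact (hcont.tendsto (X, x)).eventually (lt_mem_nhds (hX x hx))

/-- With `C` a left inverse of `B`, a kernel vector for t ≠ 1 is an eigenvector of `C ∘ₗ A` with
eigenvalue -t / (1 - t), and the spectrum is finite. -/
theorem finite_setOf_not_injective_lineMap {E V : Type*} [AddCommGroup E] [Module ℝ E]
    [FiniteDimensional ℝ E] [AddCommGroup V] [Module ℝ V] (A B : E →ₗ[ℝ] V)
    (hB : Function.Injective B) :
    {t : ℝ | ∃ x ≠ 0, ((1 - t) • A + t • B) x = 0}.Finite := by
  obtain ⟨C, hC⟩ := B.exists_leftInverse_of_injective (LinearMap.ker_eq_bot.2 hB)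
  have hfin : (spectrum ℝ (C ∘ₗ A : Module.End ℝ E)).Finite :=
    Module.End.finite_spectrum _
  refine ((hfin.image fun μ => μ / (μ - 1)).union (Set.finite_singleton 1)).subset ?_
  rintro t ⟨x, hx, h0⟩
  by_cases ht : t = 1
  · exact Or.inr ht
  left
  have ht' : 1 - t ≠ 0 := sub_ne_zero.2 (Ne.symm ht)
  have h1 : C (B x) = x := LinearMap.congr_fun hC x
  have h2 := congrArg C h0
  simp only [LinearMap.add_apply, LinearMap.smul_apply, map_add, map_smul, map_zero, h1] at h2
  have h3 : (C ∘ₗ A) x = (-t / (1 - t)) • x := by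
    rw [LinearMap.comp_apply, div_eq_inv_mul, mul_smul, neg_smul, eq_comm,
      inv_smul_eq_iff₀ ht', eq_comm]
    exact eq_neg_of_add_eq_zero_left h2
  refine ⟨-t / (1 - t), ?_, ?_⟩
  · exact (Module.End.hasEigenvalue_of_hasEigenvector
      ⟨Module.End.mem_eigenspace_iff.2 h3, hx⟩).mem_spectrum
  · field_simp
    ring

end Topology

/-! ### The two inclusions and the theorem -/

section Main

variable {ι κ : Type} [Fintype ι] [DecidableEq ι] [Fintype κ] [DecidableEq κ]

theorem isNilpotentOrbit_of_mem {D : SignedYoungDiagram}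
    (hD : (D.rows.map Prod.fst).sum = Module.finrank ℝ (ι ⊕ ι → ℝ)) {X : sp ι ℝ}
    (hX : X ∈ nilpotentOrbit D) : IsNilpotentOrbit (nilpotentOrbit D : Set (sp ι ℝ)) := by
  classical
  refine ⟨X, ?_, nilpotentOrbit_eq_adjointOrbit hD hX⟩
  obtain ⟨σ, v, h⟩ := (mem_nilpotentOrbit_iff hD X).1 hX
  exact isNilpotent_ad_of_isNilpotent_spEnd X (h.isNilpotent (spEnd_skew X)
    symplBilin_nondegenerate ((sum_toType _ Prod.fst).trans hD))

variable {U : Submodule ℝ ((κ ⊕ ι) ⊕ (κ ⊕ ι) → ℝ)} {u u' : κ → (κ ⊕ ι) ⊕ (κ ⊕ ι) → ℝ}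
  {ρ : (ι ⊕ ι → ℝ) →ₗ[ℝ] ((κ ⊕ ι) ⊕ (κ ⊕ ι) → ℝ)} {S : SignedYoungDiagram}

theorem finrank_ker_le_of_mem_induce (hS : S.IsSymplectic (Fintype.card ι)) {j : ℕ}
    (hj : j + S.rows.card ≤ Fintype.card κ) {X : sp (κ ⊕ ι) ℝ}
    (hX : X ∈ nilpotentOrbit (S.induce (Fintype.card κ) j)) :
    Module.finrank ℝ (LinearMap.ker (spEnd X)) ≤ Fintype.card κ := by
  obtain ⟨F, G, hF, hG, -, hFG⟩ := exists_definite_of_mem_induce hS hj hX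
  have := finrank_add_finrank_ker_le (spEnd_skew X) hF hG
  omega

/-- The line from a point of the open set to an element of `Y + 𝔫` with kernel `U` stays in `Y + 𝔫`.
Near its start it contains elements with kernel `U`, which lie in some `𝒪_{D^(j)}`. -/
theorem IsAdaptedFrame.inducedOrbit_subset (h : IsAdaptedFrame U u u' ρ)
    (hS : S.IsSymplectic (Fintype.card ι)) (hr : S.rows.card ≤ Fintype.card κ) :
    inducedOrbit (nilradicalOf U)
        (Set.image2 leviEmbed {(0 : Matrix κ κ ℝ)} (nilpotentOrbit S : Set (sp ι ℝ))) ⊆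
      ⋃ j ∈ Set.Iic (Fintype.card κ - S.rows.card),
        nilpotentOrbit (S.induce (Fintype.card κ) j) := by
  rintro Z ⟨_, ⟨⟨X', -, rfl⟩, W, hW, ⟨X₀, hX₀W, hX₀⟩, hsub⟩, hZ⟩
  obtain ⟨Y, hY, hU₀, hρ₀⟩ := (h.mem_add_nilradical_iff _ X₀).1 hX₀
  -- The choice j = 0 is arbitrary: any j provides an element with kernel `U`.
  obtain ⟨X₁, hU₁, hρ₁, hX₁⟩ := h.exists_mem_nilpotentOrbit hS hY (j := 0) (by omega)
  have hker₁ : U = LinearMap.ker (spEnd X₁) :=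
    Submodule.eq_of_le_of_finrank_le (fun x hx => hU₁ x hx) (by
      rw [h.finrank_eq]
      exact finrank_ker_le_of_mem_induce hS (by omega) hX₁)
  let A := U.liftQ (spEnd X₀) fun x hx => hU₀ x hx
  let B := U.liftQ (spEnd X₁) fun x hx => hU₁ x hx
  have hB : Function.Injective B :=
    LinearMap.ker_eq_bot.1 (Submodule.ker_liftQ_eq_bot _ _ _ hker₁.ge)
  let Xt : ℝ → sp (κ ⊕ ι) ℝ := fun t => (1 - t) • X₀ + t • X₁
  have hXt : ∀ t x, spEnd (Xt t) x = (1 - t) • spEnd X₀ x + t • spEnd X₁ x := fun t x => by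
    simp only [Xt, spEnd_add, spEnd_smul, LinearMap.add_apply, LinearMap.smul_apply]
  have hcont : Continuous Xt := by
    refine continuous_induced_rng.2 ?_
    change Continuous fun t : ℝ =>
      (1 - t) • (X₀ : Matrix ((κ ⊕ ι) ⊕ (κ ⊕ ι)) ((κ ⊕ ι) ⊕ (κ ⊕ ι)) ℝ) +
        t • (X₁ : Matrix ((κ ⊕ ι) ⊕ (κ ⊕ ι)) ((κ ⊕ ι) ⊕ (κ ⊕ ι)) ℝ)
    fun_prop
  have hmem : Xt ⁻¹' W ∈ nhds (0 : ℝ) :=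
    (hW.preimage hcont).mem_nhds (by simpa [Xt] using hX₀W)
  obtain ⟨t, htW, ht⟩ := ((infinite_of_mem_nhds 0 hmem).sdiff
    (finite_setOf_not_injective_lineMap A B hB)).nonempty
  have hUt : ∀ x ∈ U, spEnd (Xt t) x = 0 := fun x hx => by
    rw [hXt, hU₀ x hx, hU₁ x hx, smul_zero, smul_zero, add_zero]
  have hρt : ∀ w, spEnd (Xt t) (ρ w) - ρ (spEnd Y w) ∈ U := fun w => by
    have := U.add_mem (U.smul_mem (1 - t) (hρ₀ w)) (U.smul_mem t (hρ₁ w))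
    rw [hXt]
    convert this using 1
    module
  have hkert : Module.finrank ℝ (LinearMap.ker (spEnd (Xt t))) ≤ Fintype.card κ := by
    rw [← h.finrank_eq]
    refine Submodule.finrank_mono fun x hx => ?_
    by_contra hxU
    refine ht ⟨U.mkQ x, by simpa using hxU, ?_⟩
    rw [LinearMap.mem_ker, hXt] at hx
    exact hx
  obtain ⟨j, hj, hXj⟩ := h.exists_mem_induce hS hY hUt hρt hkert
  have hXC : Xt t ∈ adjointOrbit X' :=
    hsub ⟨htW, (h.mem_add_nilradical_iff _ _).2 ⟨Y, hY, hUt, hρt⟩⟩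
  simp only [Set.mem_iUnion]
  refine ⟨j, by rw [Set.mem_Iic]; omega, ?_⟩
  rw [nilpotentOrbit_eq_adjointOrbit (hS.induce_finrank_eq hj) hXj, adjointOrbit_eq hXC]
  exact hZ

/-- The open set consists of the X whose form is positive on `F` and negative on `G`, for subspaces
definite for one element of the orbit. Together they bound the kernel by k, so X lies in some
`𝒪_{D^(j')}`; `F` gives j' ≤ j and `G` gives j ≤ j'. -/
theorem IsAdaptedFrame.subset_inducedOrbit (h : IsAdaptedFrame U u u' ρ)
    (hS : S.IsSymplectic (Fintype.card ι)) {j : ℕ} (hj : j + S.rows.card ≤ Fintype.card κ) :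
    nilpotentOrbit (S.induce (Fintype.card κ) j) ⊆ inducedOrbit (nilradicalOf U)
      (Set.image2 leviEmbed {(0 : Matrix κ κ ℝ)} (nilpotentOrbit S : Set (sp ι ℝ))) := by
  obtain ⟨Y, hY⟩ := nilpotentOrbit_nonempty (ι := ι) hS
  obtain ⟨X₀, hU₀, hρ₀, hX₀⟩ := h.exists_mem_nilpotentOrbit hS hY hj
  obtain ⟨F, G, hF, hG, hFd, hFG⟩ := exists_definite_of_mem_induce hS hj hX₀
  refine Set.subset_sUnion_of_mem ⟨isNilpotentOrbit_of_mem (hS.induce_finrank_eq hj) hX₀, _,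
    (isOpen_setOf_pos_definite F 1).inter (isOpen_setOf_pos_definite G (-1)), ⟨X₀, ⟨?_, ?_⟩, ?_⟩,
    ?_⟩
  · exact fun x hx h0 => by simpa using hF x hx h0
  · exact fun x hx h0 => by simpa using hG x hx h0
  · exact (h.mem_add_nilradical_iff _ _).2 ⟨Y, hY, hU₀, hρ₀⟩
  · rintro X ⟨⟨hXF, hXG⟩, hX⟩
    obtain ⟨Y', hY', hU, hρ⟩ := (h.mem_add_nilradical_iff _ _).1 hX
    have hker := finrank_add_finrank_ker_le (spEnd_skew X)
      (fun x hx h0 => by simpa using hXF x hx h0) (fun x hx h0 => by simpa using hXG x hx h0)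
    obtain ⟨j', hj', hXj'⟩ := h.exists_mem_induce hS hY' hU hρ (by omega)
    have hFG' : (Module.finrank ℝ F : ℝ) + Module.finrank ℝ G + Fintype.card κ =
      Module.finrank ℝ ((κ ⊕ ι) ⊕ (κ ⊕ ι) → ℝ) := by exact_mod_cast hFG
    have h1 := le_of_pos_definite (c := j) hS hj' hXj' 1 (by norm_num) hXF (by linarith)
    have h2 := le_of_pos_definite (c := j) hS hj' hXj' (-1) (by norm_num) hXG (by linarith)
    have h3 : (j' : ℝ) = j := by linarith
    have h4 : j' = j := by exact_mod_cast h3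
    rwa [h4] at hXj'

theorem IsAdaptedFrame.inducedOrbit_eq (h : IsAdaptedFrame U u u' ρ)
    (hS : S.IsSymplectic (Fintype.card ι)) (hr : S.rows.card ≤ Fintype.card κ) :
    inducedOrbit (nilradicalOf U)
        (Set.image2 leviEmbed {(0 : Matrix κ κ ℝ)} (nilpotentOrbit S : Set (sp ι ℝ))) =
      ⋃ j ∈ Set.Iic (Fintype.card κ - S.rows.card),
        nilpotentOrbit (S.induce (Fintype.card κ) j) :=
  (h.inducedOrbit_subset hS hr).antisymm (Set.iUnion₂_subset fun j hj =>
    h.subset_inducedOrbit hS (by rw [Set.mem_Iic] at hj; omega))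

theorem exists_mem_induce (hS : S.IsSymplectic (Fintype.card ι)) {j : ℕ}
    (hj : j + S.rows.card ≤ Fintype.card κ) :
    ∃ X : sp (κ ⊕ ι) ℝ, X ∈ nilpotentOrbit (S.induce (Fintype.card κ) j) := by
  obtain ⟨Y, hY⟩ := nilpotentOrbit_nonempty (ι := ι) hS
  obtain ⟨X, -, -, hX⟩ := isAdaptedFrame_left.exists_mem_nilpotentOrbit hS hY hj
  exact ⟨X, hX⟩

end Main

theorem mainTheorem11 (m n : ℕ) (hmn : m ≤ n) (S : SignedYoungDiagram) (hS : S.IsSymplectic m)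
    (hr : S.rows.card ≤ n - m)
    (U : Submodule ℝ ((Fin (n - m) ⊕ Fin m) ⊕ (Fin (n - m) ⊕ Fin m) → ℝ))
    (hU : U = isotropicLeft (Fin (n - m)) (Fin m) ∨ U = isotropicRight (Fin (n - m)) (Fin m)) :
    (∀ j ≤ n - m - S.rows.card, (S.induce (n - m) j).IsSymplectic n ∧
      IsNilpotentOrbit
        (nilpotentOrbit (S.induce (n - m) j) : Set (sp (Fin (n - m) ⊕ Fin m) ℝ))) ∧
    (∀ i ≤ n - m - S.rows.card, ∀ j ≤ n - m - S.rows.card,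
      (nilpotentOrbit (S.induce (n - m) i) : Set (sp (Fin (n - m) ⊕ Fin m) ℝ)) =
        nilpotentOrbit (S.induce (n - m) j) → i = j) ∧
    inducedOrbit (nilradicalOf U)
        (Set.image2 leviEmbed {0} (nilpotentOrbit S : Set (sp (Fin m) ℝ))) =
      ⋃ j ∈ Set.Iic (n - m - S.rows.card), nilpotentOrbit (S.induce (n - m) j) := by
  have hS' : S.IsSymplectic (Fintype.card (Fin m)) := by rwa [Fintype.card_fin]
  have hk : Fintype.card (Fin (n - m)) = n - m := Fintype.card_fin _
  have hex : ∀ j ≤ n - m - S.rows.card, ∃ X : sp (Fin (n - m) ⊕ Fin m) ℝ,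
      X ∈ nilpotentOrbit (S.induce (n - m) j) := fun j hj => by
    have := exists_mem_induce (κ := Fin (n - m)) hS' (j := j) (by rw [hk]; omega)
    rwa [hk] at this
  refine ⟨fun j hj => ⟨?_, ?_⟩, fun i hi j hj hij => ?_, ?_⟩
  · have := hS.induce (k := n - m) (j := j) (by omega)
    rwa [Nat.add_sub_cancel' hmn] at this
  · obtain ⟨X, hX⟩ := hex j hj
    refine isNilpotentOrbit_of_mem ?_ hX
    have := hS'.induce_finrank_eq (κ := Fin (n - m)) (j := j) (by rw [hk]; omega)
    rwa [hk] at this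
  · obtain ⟨X, hX⟩ := hex i hi
    refine nilpotentOrbit_induce_injective (κ := Fin (n - m)) (ι := Fin m) hS' (X := X)
      (by rw [hk]; omega) (by rw [hk]; omega) (by rwa [hk]) ?_
    rw [hk, ← hij]
    exact hX
  · have key : ∀ {u u' ρ}, IsAdaptedFrame U u u' ρ → _ := fun h =>
      h.inducedOrbit_eq hS' (by rwa [hk])
    rw [hk] at key
    rcases hU with rfl | rfl
    · exact key isAdaptedFrame_left
    · exact key isAdaptedFrame_right
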